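/- Let $(M,\phi,\xi,\eta,g)$ be a $3$-dimensional contact metric manifold: $M$ is a smooth $3$-manifold with a smooth Riemannian metric $g$, and $\phi$, $\xi$, $\eta$ are a smooth $(1,1)$-tensor field, vector field and $1$-form such that, for all vector fields $X,Y$, $$\phi^2X=-X+\eta(X)\xi,\quad \phi\xi=0,\quad \eta\circ\phi=0,\quad \eta(\xi)=1,$$ $$g(\phi X,\phi Y)=g(X,Y)-\eta(X)\eta(Y),\quad \eta(X)=g(\xi,X),\quad d\eta(X,Y)=g(X,\phi Y),$$ where $d\eta(X,Y)=\tfrac12\bigl(X\eta(Y)-Y\eta(X)-\eta([X,Y])\bigr)$. Let $\nabla$ be the Levi-Civita connection of $g$, $R(X,Y)Z=[\nabla_X,\nabla_Y]Z-\nabla_{[X,Y]}Z$ its curvature tensor, $\rho(Y,Z)=\operatorname{tr}(X\mapsto R(X,Y)Z)$ the Ricci tensor, $Q$ the Ricci operator, given by $g(QX,Y)=\rho(X,Y)$, and $\tau=\operatorname{tr}Q$ the scalar curvature; let $h=\tfrac12\mathcal L_\xi\phi$. Suppose that $M$ is H-contact, i.e. that $Q\xi=f\xi$ for some function $f$ on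 $M$. Then the function $\tau+\operatorname{tr}h^2$ is differentiable, and $$\xi\bigl(\tau+\operatorname{tr}h^2\bigr)=0\quad\text{on }M.$$ -/

import Mathlib

/-!
Contact metric geometry on a smooth Riemannian manifold of dimension `m`.

The Riemannian metric is the inner product `inner ℝ u v` on the tangent spaces, varying smoothly
with the base point. Tensors are evaluated on tangent vectors by extending these to vector fields
that are smooth near the point (`FiberBundle.extend`, constant in a local trivialization); the value
does not depend on the extension. Traces are computed in an orthonormal basis of the tangent space.
-/

open scoped Manifold ContDiff Bundle

noncomputable section

namespace ContactMetric

section VectorFields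

variable {m : ℕ} {M : Type*} [TopologicalSpace M] [ChartedSpace (EuclideanSpace ℝ (Fin m)) M]

/-- Vector fields on `M` (not assumed smooth). -/
abbrev VF (m : ℕ) (M : Type*) [TopologicalSpace M]
    [ChartedSpace (EuclideanSpace ℝ (Fin m)) M] : Type _ :=
  (x : M) → TangentSpace (𝓡 m) x

/-- Fields of endomorphisms of the tangent spaces, i.e. `(1,1)`-tensor fields. -/
abbrev EndField (m : ℕ) (M : Type*) [TopologicalSpace M]
    [ChartedSpace (EuclideanSpace ℝ (Fin m)) M] : Type _ :=
  (x : M) → TangentSpace (𝓡 m) x →L[ℝ] TangentSpace (𝓡 m) x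

/-- Fields of covectors, i.e. `1`-forms. -/
abbrev OneForm (m : ℕ) (M : Type*) [TopologicalSpace M]
    [ChartedSpace (EuclideanSpace ℝ (Fin m)) M] : Type _ :=
  (x : M) → TangentSpace (𝓡 m) x →L[ℝ] ℝ

/-- The derivative `v f` of a function `f` at `x` in the direction of a tangent vector `v`. -/
def dirDeriv (f : M → ℝ) (x : M) (v : TangentSpace (𝓡 m) x) : ℝ :=
  mvfderiv (𝓡 m) f x v

/-- The Lie bracket of two vector fields. -/
def bracket (X Y : VF m M) : VF m M :=
  VectorField.mlieBracket (𝓡 m) X Y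

variable [IsManifold (𝓡 m) ∞ M]

/-- An extension of the tangent vector `v` at `x` to a vector field that is smooth near `x`. -/
def extend {x : M} (v : TangentSpace (𝓡 m) x) : VF m M :=
  FiberBundle.extend (EuclideanSpace ℝ (Fin m)) v

/-- The exterior derivative of a `1`-form, in the normalization
`dη(X, Y) = (X η(Y) - Y η(X) - η([X, Y])) / 2`. -/
def extDeriv (η : OneForm m M) (x : M) (u v : TangentSpace (𝓡 m) x) : ℝ :=
  (1 / 2) * (dirDeriv (fun y ↦ η y (extend v y)) x u - dirDeriv (fun y ↦ η y (extend u y)) x v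
    - η x (bracket (extend u) (extend v) x))

/-- The tensor `h = (1/2) L_ξ φ`, where `(L_ξ φ) V = [ξ, φ V] - φ [ξ, V]`. -/
def hTensor (φ : EndField m M) (ξ : VF m M) (x : M) (v : TangentSpace (𝓡 m) x) :
    TangentSpace (𝓡 m) x :=
  (1 / 2 : ℝ) • (bracket ξ (fun y ↦ φ y (extend v y)) x - φ x (bracket ξ (extend v) x))

end VectorFields

section Riemannian

variable {m : ℕ} {M : Type*} [TopologicalSpace M] [ChartedSpace (EuclideanSpace ℝ (Fin m)) M]
  [IsManifold (𝓡 m) ∞ M]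
  [Bundle.RiemannianBundle (fun x : M ↦ TangentSpace (𝓡 m) x)]

/-- The function `g(X, Y)` for two vector fields `X`, `Y`. -/
def metric (X Y : VF m M) (x : M) : ℝ :=
  inner ℝ (X x) (Y x)

instance (x : M) : FiniteDimensional ℝ (TangentSpace (𝓡 m) x) :=
  inferInstanceAs (FiniteDimensional ℝ (EuclideanSpace ℝ (Fin m)))

/-- An orthonormal basis of the tangent space at `x`. -/
def onb (x : M) : OrthonormalBasis (Fin (Module.finrank ℝ (TangentSpace (𝓡 m) x))) ℝ
    (TangentSpace (𝓡 m) x) :=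
  stdOrthonormalBasis ℝ (TangentSpace (𝓡 m) x)

/-- The right-hand side of the Koszul formula; it equals `g(∇_X Y, Z)`. -/
def koszul (X Y Z : VF m M) (x : M) : ℝ :=
  (1 / 2) * (dirDeriv (metric Y Z) x (X x) + dirDeriv (metric X Z) x (Y x)
    - dirDeriv (metric X Y) x (Z x)
    + metric (bracket X Y) Z x - metric (bracket X Z) Y x - metric (bracket Y Z) X x)

/-- The Levi-Civita connection: `nabla X Y` is `∇_X Y`, the vector field determined by the
Koszul formula. -/
def nabla (X Y : VF m M) : VF m M := fun x ↦
  ∑ i, koszul X Y (extend (onb x i)) x • onb x i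

/-- The curvature operator `R(X, Y) Z = ∇_X ∇_Y Z - ∇_Y ∇_X Z - ∇_{[X, Y]} Z` on vector fields. -/
def curvatureVF (X Y Z : VF m M) : VF m M :=
  nabla X (nabla Y Z) - nabla Y (nabla X Z) - nabla (bracket X Y) Z

/-- The curvature tensor `R(u, v) w` on tangent vectors. -/
def curvature {x : M} (u v w : TangentSpace (𝓡 m) x) : TangentSpace (𝓡 m) x :=
  curvatureVF (extend u) (extend v) (extend w) x

/-- The Ricci tensor `ρ(v, w)`, the trace of `u ↦ R(u, v) w`. -/
def ricci {x : M} (v w : TangentSpace (𝓡 m) x) : ℝ :=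
  ∑ i, inner ℝ (curvature (onb x i) v w) (onb x i)

/-- The Ricci operator `Q`, with `g(Q v, w) = ρ(v, w)`. -/
def ricciOp {x : M} (v : TangentSpace (𝓡 m) x) : TangentSpace (𝓡 m) x :=
  ∑ i, ricci v (onb x i) • onb x i

variable (m) in
/-- The scalar curvature `τ`, the trace of `Q`. -/
def scalarCurvature (x : M) : ℝ :=
  ∑ i, ricci (m := m) (onb x i) (onb x i)

/-- The function `tr h²`. -/
def trHSq (φ : EndField m M) (ξ : VF m M) (x : M) : ℝ :=
  ∑ i, inner ℝ (hTensor φ ξ x (hTensor φ ξ x (onb x i))) (onb x i)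

/-- `(φ, ξ, η, g)` is a contact metric structure: a smooth almost contact metric structure
satisfying `dη(X, Y) = g(X, φ Y)`. (It follows that `η ∧ (dη)ⁿ` vanishes nowhere.) -/
structure IsContactMetric (φ : EndField m M) (ξ : VF m M) (η : OneForm m M) : Prop where
  smooth_phi : ContMDiff (𝓡 m)
    ((𝓡 m).prod 𝓘(ℝ, EuclideanSpace ℝ (Fin m) →L[ℝ] EuclideanSpace ℝ (Fin m))) ∞
    (fun x ↦ Bundle.TotalSpace.mk' (EuclideanSpace ℝ (Fin m) →L[ℝ] EuclideanSpace ℝ (Fin m))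
      (E := fun x : M ↦ TangentSpace (𝓡 m) x →L[ℝ] TangentSpace (𝓡 m) x) x (φ x))
  smooth_xi : ContMDiff (𝓡 m) ((𝓡 m).prod 𝓘(ℝ, EuclideanSpace ℝ (Fin m))) ∞
    (fun x ↦ Bundle.TotalSpace.mk' (EuclideanSpace ℝ (Fin m))
      (E := fun x : M ↦ TangentSpace (𝓡 m) x) x (ξ x))
  smooth_eta : ContMDiff (𝓡 m) ((𝓡 m).prod 𝓘(ℝ, EuclideanSpace ℝ (Fin m) →L[ℝ] ℝ)) ∞
    (fun x ↦ Bundle.TotalSpace.mk' (EuclideanSpace ℝ (Fin m) →L[ℝ] ℝ)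
      (E := fun x : M ↦ TangentSpace (𝓡 m) x →L[ℝ] ℝ) x (η x))
  phi_sq : ∀ (x : M) (v : TangentSpace (𝓡 m) x), φ x (φ x v) = -v + η x v • ξ x
  phi_xi : ∀ x : M, φ x (ξ x) = 0
  eta_phi : ∀ (x : M) (v : TangentSpace (𝓡 m) x), η x (φ x v) = 0
  eta_xi : ∀ x : M, η x (ξ x) = 1
  metric_phi : ∀ (x : M) (u v : TangentSpace (𝓡 m) x),
    inner ℝ (φ x u) (φ x v) = inner ℝ u v - η x u * η x v
  eta_eq : ∀ (x : M) (v : TangentSpace (𝓡 m) x), η x v = inner ℝ (ξ x) v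
  d_eta : ∀ (x : M) (u v : TangentSpace (𝓡 m) x), extDeriv η x u v = inner ℝ u (φ x v)

/-- The H-contact condition: `Q ξ = f ξ` for some function `f`. -/
def IsHContact (ξ : VF m M) : Prop :=
  ∃ f : M → ℝ, ∀ x, ricciOp (ξ x) = f x • ξ x

end Riemannian

end ContactMetric

end

/-! Near any point there is a smooth orthonormal frame `(E 0, E 1, E 2) = (e, φ e, ξ)`. Everything
is expressed through its structure functions `structFn E i j k`, that is g([E i, E j], E k). The
contact condition fixes the ξ-components of the brackets: g([e, φe], ξ) = 2, while [ξ, e] and [ξ,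
φe] have none. The Jacobi identity then gives g([ξ, φe], φe) = -g([ξ, e], e). What remains is [ξ, e]
= a e + b φe, [ξ, φe] = c e - a φe and [e, φe] = p e + q φe + 2ξ.

In these terms tr h² = 2a² + (b + c)²/2 (`trHSq_eq`), and τ contains exactly the negative of this
expression (`ricci_eq`). Hence, with F = τ + tr h², F = -2 + 2b - 2c - 2p² - 2q² - 2 (φe)p + 2 e(q),
which is a smooth function.

The H-contact condition says that ρ(ξ, e) and ρ(ξ, φe) vanish on the whole neighbourhood, so these
equations may be differentiated. In e ρ(ξ, e) + (φe) ρ(ξ, φe) = 0, the second derivatives of b and c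
occur only in the combination (1/2)[e, φe](b - c), whose ξ-part is ξ(b - c), and the others are e ξ
q - (φe) ξ p. Up to commutators these are the terms of (1/2) ξF. The first-order terms cancel by the
undifferentiated Ricci equations and by the Jacobi identities for ξp and ξq.

The preliminary work shows that the pointwise definitions, made with arbitrary extensions and
arbitrary orthonormal bases, are tensorial and so can be computed in the frame. -/

namespace ContactMetric

open Filter Topology

/-! ### Germs of smooth functions and vector fields, directional derivatives, Lie brackets -/

section Smooth

variable {m : ℕ} {M : Type*} [TopologicalSpace M] [ChartedSpace (EuclideanSpace ℝ (Fin m)) M]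

variable (m) in
/-- The function `f` is smooth at all points near `x`. -/
def SmoothFn (f : M → ℝ) (x : M) : Prop :=
  ∀ᶠ y in 𝓝 x, ContMDiffAt (𝓡 m) 𝓘(ℝ, ℝ) ∞ f y

namespace SmoothFn

variable {f g : M → ℝ} {x : M}

theorem contMDiffAt (hf : SmoothFn m f x) : ContMDiffAt (𝓡 m) 𝓘(ℝ, ℝ) ∞ f x :=
  hf.self_of_nhds

theorem mdifferentiableAt (hf : SmoothFn m f x) : MDifferentiableAt (𝓡 m) 𝓘(ℝ, ℝ) f x :=
  hf.contMDiffAt.mdifferentiableAt (by simp)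

theorem eventually (hf : SmoothFn m f x) : ∀ᶠ y in 𝓝 x, SmoothFn m f y :=
  eventually_eventually_nhds.2 hf

theorem congr (hf : SmoothFn m f x) (h : g =ᶠ[𝓝 x] f) : SmoothFn m g x := by
  filter_upwards [hf, eventually_eventually_nhds.2 h] with y hy hgy
  exact hy.congr_of_eventuallyEq hgy

theorem const (c : ℝ) (x : M) : SmoothFn m (fun _ : M ↦ c) x :=
  Eventually.of_forall fun _ ↦ contMDiffAt_const

theorem add (hf : SmoothFn m f x) (hg : SmoothFn m g x) : SmoothFn m (fun y ↦ f y + g y) x := by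
  filter_upwards [hf, hg] with y hy hy' using hy.add hy'

theorem sub (hf : SmoothFn m f x) (hg : SmoothFn m g x) : SmoothFn m (fun y ↦ f y - g y) x := by
  filter_upwards [hf, hg] with y hy hy' using hy.sub hy'

theorem mul (hf : SmoothFn m f x) (hg : SmoothFn m g x) : SmoothFn m (fun y ↦ f y * g y) x := by
  filter_upwards [hf, hg] with y hy hy' using hy.mul hy'

theorem neg (hf : SmoothFn m f x) : SmoothFn m (fun y ↦ -f y) x := by
  filter_upwards [hf] with y hy using hy.neg

end SmoothFn

section DirDeriv

variable {f g : M → ℝ} {x : M}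

theorem dirDeriv_congr (h : f =ᶠ[𝓝 x] g) (v : TangentSpace (𝓡 m) x) :
    dirDeriv f x v = dirDeriv g x v := by
  have h1 : mfderiv (𝓡 m) 𝓘(ℝ, ℝ) f x = mfderiv (𝓡 m) 𝓘(ℝ, ℝ) g x := h.mfderiv_eq
  have h2 : f x = g x := h.self_of_nhds
  simp only [dirDeriv, mvfderiv, h1]
  rfl

theorem dirDeriv_const (c : ℝ) (v : TangentSpace (𝓡 m) x) : dirDeriv (fun _ : M ↦ c) x v = 0 := by
  rw [dirDeriv, mvfderiv_const]; rfl

theorem dirDeriv_add (hf : SmoothFn m f x) (hg : SmoothFn m g x) (v : TangentSpace (𝓡 m) x) :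
    dirDeriv (fun y ↦ f y + g y) x v = dirDeriv f x v + dirDeriv g x v := by
  simp only [dirDeriv]
  rw [mvfderiv_fun_add hf.mdifferentiableAt hg.mdifferentiableAt]; rfl

theorem dirDeriv_sub (hf : SmoothFn m f x) (hg : SmoothFn m g x) (v : TangentSpace (𝓡 m) x) :
    dirDeriv (fun y ↦ f y - g y) x v = dirDeriv f x v - dirDeriv g x v := by
  simp only [dirDeriv]
  rw [mvfderiv_fun_sub hf.mdifferentiableAt hg.mdifferentiableAt]; rfl

theorem dirDeriv_neg (v : TangentSpace (𝓡 m) x) :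
    dirDeriv (fun y ↦ -f y) x v = -dirDeriv f x v := by
  simp only [dirDeriv]
  rw [mvfderiv_fun_neg]; rfl

theorem dirDeriv_mul (hf : SmoothFn m f x) (hg : SmoothFn m g x) (v : TangentSpace (𝓡 m) x) :
    dirDeriv (fun y ↦ f y * g y) x v = f x * dirDeriv g x v + g x * dirDeriv f x v := by
  simp only [dirDeriv]
  rw [mvfderiv_fun_mul hf.mdifferentiableAt hg.mdifferentiableAt]; rfl

theorem dirDeriv_vec_add (u v : TangentSpace (𝓡 m) x) :
    dirDeriv f x (u + v) = dirDeriv f x u + dirDeriv f x v := map_add _ _ _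

theorem dirDeriv_vec_smul (c : ℝ) (v : TangentSpace (𝓡 m) x) :
    dirDeriv f x (c • v) = c * dirDeriv f x v := by
  simp [dirDeriv]

end DirDeriv

section Bracket

variable {X Y X' Y' : VF m M} {x : M}

theorem bracket_congr (hX : ∀ᶠ y in 𝓝 x, X y = X' y)
    (hY : ∀ᶠ y in 𝓝 x, Y y = Y' y) :
    bracket X Y x = bracket X' Y' x :=
  Filter.EventuallyEq.mlieBracket_vectorField_eq hX hY

theorem bracket_swap (X Y : VF m M) : bracket X Y = -bracket Y X :=
  VectorField.mlieBracket_swap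

end Bracket

variable [IsManifold (𝓡 m) ∞ M]

/-- The vector field `X` is smooth at all points near `x`. -/
def SmoothVF (X : VF m M) (x : M) : Prop :=
  ∀ᶠ y in 𝓝 x, ContMDiffAt (𝓡 m) ((𝓡 m).prod 𝓘(ℝ, EuclideanSpace ℝ (Fin m))) ∞
    (fun z ↦ Bundle.TotalSpace.mk' (EuclideanSpace ℝ (Fin m))
      (E := fun x : M ↦ TangentSpace (𝓡 m) x) z (X z)) y

namespace SmoothVF

variable {X Y : VF m M} {f : M → ℝ} {x : M}

theorem contMDiffAt (hX : SmoothVF X x) :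
    ContMDiffAt (𝓡 m) ((𝓡 m).prod 𝓘(ℝ, EuclideanSpace ℝ (Fin m))) ∞
      (fun z ↦ Bundle.TotalSpace.mk' (EuclideanSpace ℝ (Fin m))
        (E := fun x : M ↦ TangentSpace (𝓡 m) x) z (X z)) x :=
  hX.self_of_nhds

theorem mdifferentiableAt (hX : SmoothVF X x) :
    MDifferentiableAt (𝓡 m) ((𝓡 m).prod 𝓘(ℝ, EuclideanSpace ℝ (Fin m)))
      (fun z ↦ Bundle.TotalSpace.mk' (EuclideanSpace ℝ (Fin m))
        (E := fun x : M ↦ TangentSpace (𝓡 m) x) z (X z)) x :=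
  hX.contMDiffAt.mdifferentiableAt (by simp)

theorem eventually (hX : SmoothVF X x) : ∀ᶠ y in 𝓝 x, SmoothVF X y :=
  eventually_eventually_nhds.2 hX

theorem congr (hX : SmoothVF X x) (h : ∀ᶠ y in 𝓝 x, Y y = X y) :
    SmoothVF Y x := by
  filter_upwards [hX, eventually_eventually_nhds.2 h] with y hy hgy
  refine hy.congr_of_eventuallyEq ?_
  filter_upwards [hgy] with z hz
  rw [hz]

theorem extend {x : M} (v : TangentSpace (𝓡 m) x) : SmoothVF (ContactMetric.extend v) x := by
  obtain ⟨s, hs, h⟩ := FiberBundle.exists_contMDiffOn_extend (k := ∞) (𝓡 m)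
    (EuclideanSpace ℝ (Fin m)) v
  filter_upwards [eventually_eventually_nhds.2 hs] with y hy
  exact (h y hy.self_of_nhds).contMDiffAt hy

theorem add (hX : SmoothVF X x) (hY : SmoothVF Y x) : SmoothVF (X + Y) x := by
  filter_upwards [hX, hY] with y hy hy' using hy.add_section hy'

theorem smul (hf : SmoothFn m f x) (hX : SmoothVF X x) : SmoothVF (f • X) x := by
  filter_upwards [hf, hX] with y hy hy' using hy.smul_section hy'

theorem sub (hX : SmoothVF X x) (hY : SmoothVF Y x) : SmoothVF (X - Y) x := by
  filter_upwards [hX, hY] with y hy hy' using hy.sub_section hy'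

theorem sum {ι : Type*} (s : Finset ι) {X : ι → VF m M} (hX : ∀ i, SmoothVF (X i) x) :
    SmoothVF (∑ i ∈ s, X i) x := by
  classical
  induction s using Finset.induction_on with
  | empty =>
    simp only [Finset.sum_empty]
    exact Eventually.of_forall fun y ↦
      (Bundle.contMDiff_zeroSection ℝ (fun x : M ↦ TangentSpace (𝓡 m) x)).contMDiffAt
  | insert a s ha h => rw [Finset.sum_insert ha]; exact (hX a).add h

theorem bracket (hX : SmoothVF X x) (hY : SmoothVF Y x) : SmoothVF (bracket X Y) x := by
  have : IsManifold (𝓡 m) (minSmoothness ℝ 2) M := by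
    rw [minSmoothness_of_isRCLikeNormedField]
    exact IsManifold.of_le (n := ∞) (WithTop.coe_le_coe.2 (le_top : (2 : ℕ∞) ≤ ⊤))
  have : IsManifold (𝓡 m) (((⊤ : ℕ∞) : WithTop ℕ∞) + 1) M := by simpa using ‹IsManifold (𝓡 m) ∞ M›
  filter_upwards [hX, hY] with y hy hy'
  exact ContMDiffAt.mlieBracket_vectorField (m := ⊤) (n := ⊤) hy hy' (by
    rw [minSmoothness_of_isRCLikeNormedField]; simp)

end SmoothVF

theorem extend_self {x : M} (v : TangentSpace (𝓡 m) x) : extend v x = v :=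
  FiberBundle.extend_apply_self _ v

section Bracket

variable {X Y Z : VF m M} {X' Y' : VF m M} {f : M → ℝ} {x : M}

theorem bracket_smul_right (X : VF m M) (hf : SmoothFn m f x) (hY : SmoothVF Y x) :
    bracket X (f • Y) x = dirDeriv f x (X x) • Y x + f x • bracket X Y x :=
  VectorField.mlieBracket_smul_right hf.mdifferentiableAt hY.mdifferentiableAt

theorem bracket_smul_left (Y : VF m M) (hf : SmoothFn m f x) (hX : SmoothVF X x) :
    bracket (f • X) Y x = -dirDeriv f x (Y x) • X x + f x • bracket X Y x :=
  VectorField.mlieBracket_smul_left hf.mdifferentiableAt hX.mdifferentiableAt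

theorem bracket_add_right (X : VF m M) (hY : SmoothVF Y x) (hY' : SmoothVF Y' x) :
    bracket X (Y + Y') x = bracket X Y x + bracket X Y' x :=
  VectorField.mlieBracket_add_right hY.mdifferentiableAt hY'.mdifferentiableAt

theorem bracket_add_left (Y : VF m M) (hX : SmoothVF X x) (hX' : SmoothVF X' x) :
    bracket (X + X') Y x = bracket X Y x + bracket X' Y x :=
  VectorField.mlieBracket_add_left hX.mdifferentiableAt hX'.mdifferentiableAt

theorem bracket_jacobi (hX : SmoothVF X x) (hY : SmoothVF Y x) (hZ : SmoothVF Z x) :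
    bracket X (bracket Y Z) x = bracket (bracket X Y) Z x + bracket Y (bracket X Z) x := by
  have : IsManifold (𝓡 m) (minSmoothness ℝ 3) M := by
    rw [minSmoothness_of_isRCLikeNormedField]
    exact IsManifold.of_le (n := ∞) (WithTop.coe_le_coe.2 (le_top : (3 : ℕ∞) ≤ ⊤))
  have h2 : minSmoothness ℝ 2 ≤ ∞ := by
    rw [minSmoothness_of_isRCLikeNormedField]; exact WithTop.coe_le_coe.2 (le_top : (2 : ℕ∞) ≤ ⊤)
  exact VectorField.leibniz_identity_mlieBracket_apply (hX.contMDiffAt.of_le h2)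
    (hY.contMDiffAt.of_le h2) (hZ.contMDiffAt.of_le h2)

end Bracket

end Smooth

/-! ### Tensoriality -/

section Tensorial

variable {m : ℕ} {M : Type*} [TopologicalSpace M] [ChartedSpace (EuclideanSpace ℝ (Fin m)) M]
  [IsManifold (𝓡 m) ∞ M]

/-- An operation on vector fields is tensorial at `x` if it is linear over the functions that are
smooth near `x`. -/
structure IsTensorial {A : Type*} [AddCommGroup A] [Module ℝ A] (Φ : VF m M → A) (x : M) :
    Prop where
  smul : ∀ {f : M → ℝ} {X : VF m M}, SmoothFn m f x → SmoothVF X x → Φ (f • X) = f x • Φ X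
  add : ∀ {X Y : VF m M}, SmoothVF X x → SmoothVF Y x → Φ (X + Y) = Φ X + Φ Y

namespace IsTensorial

variable {A : Type*} [AddCommGroup A] [Module ℝ A] {Φ : VF m M → A} {x : M}

/-- Linearity over germs already forces locality. The indicator ψ of the set where X = Y is
identically 1 near x, hence smooth there, and ψX = ψY everywhere. No smooth cut-off function is
needed. -/
theorem congr (hΦ : IsTensorial Φ x) {X Y : VF m M} (hX : SmoothVF X x) (hXY : ∀ᶠ y in 𝓝 x, X y = Y y) :
    Φ X = Φ Y := by
  classical
  let ψ : M → ℝ := fun y ↦ if X y = Y y then 1 else 0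
  have hψ : SmoothFn m ψ x :=
    (SmoothFn.const 1 x).congr (by filter_upwards [hXY] with y hy; simp [ψ, hy])
  have hψx : ψ x = 1 := by simp [ψ, hXY.self_of_nhds]
  have h : ψ • X = ψ • Y := by
    funext y
    by_cases hy : X y = Y y <;> simp [ψ, hy]
  have h1 := hΦ.smul hψ hX
  have h2 := hΦ.smul hψ (hX.congr (hXY.mono fun _ h ↦ h.symm))
  rw [hψx, one_smul] at h1 h2
  rw [← h1, ← h2, h]

theorem sum (hΦ : IsTensorial Φ x) {ι : Type*} (s : Finset ι) {X : ι → VF m M}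
    (hX : ∀ i, SmoothVF (X i) x) : Φ (∑ i ∈ s, X i) = ∑ i ∈ s, Φ (X i) := by
  classical
  induction s using Finset.induction_on with
  | empty =>
    have h := hΦ.smul (SmoothFn.const 0 x) (SmoothVF.sum (∅ : Finset ι) hX)
    simp only [Finset.sum_empty, smul_zero, zero_smul] at h ⊢
    exact h
  | insert a s ha h =>
    rw [Finset.sum_insert ha, Finset.sum_insert ha, hΦ.add (hX a) (SmoothVF.sum s hX), h]

end IsTensorial

end Tensorial

/-! ### Algebra of the metric on vector fields -/

section Metric

variable {m : ℕ} {M : Type*} [TopologicalSpace M] [ChartedSpace (EuclideanSpace ℝ (Fin m)) M]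
  [Bundle.RiemannianBundle (fun x : M ↦ TangentSpace (𝓡 m) x)]

variable {f : M → ℝ} {X Y Z : VF m M}

theorem metric_comm (X Y : VF m M) : metric X Y = metric Y X := by
  funext x; exact real_inner_comm _ _

theorem metric_add_left : metric (X + Y) Z = fun x ↦ metric X Z x + metric Y Z x := by
  funext x; exact inner_add_left _ _ _

theorem metric_add_right : metric X (Y + Z) = fun x ↦ metric X Y x + metric X Z x := by
  funext x; exact inner_add_right _ _ _

theorem metric_smul_left : metric (f • X) Y = fun x ↦ f x * metric X Y x := by
  funext x; exact real_inner_smul_left _ _ _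

theorem metric_smul_right : metric X (f • Y) = fun x ↦ f x * metric X Y x := by
  funext x; exact real_inner_smul_right _ _ _

theorem metric_neg_left : metric (-X) Y = fun x ↦ -metric X Y x := by
  funext x; exact inner_neg_left _ _

end Metric

/-! ### Orthonormal frames and second derivatives of functions -/

section Frame

variable {m : ℕ} {M : Type*} [TopologicalSpace M] [ChartedSpace (EuclideanSpace ℝ (Fin m)) M]
  [IsManifold (𝓡 m) ∞ M]
  [Bundle.RiemannianBundle (fun x : M ↦ TangentSpace (𝓡 m) x)]

/-- A smooth orthonormal frame near `x`. -/
structure IsFrame (E : Fin m → VF m M) (x : M) : Prop where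
  smooth : ∀ i, SmoothVF (E i) x
  orthonormal : ∀ᶠ y in 𝓝 x, ∀ i j, metric (E i) (E j) y = if i = j then 1 else 0

namespace IsFrame

variable {E : Fin m → VF m M} {x : M}

theorem eventually (hE : IsFrame E x) : ∀ᶠ y in 𝓝 x, IsFrame E y := by
  filter_upwards [eventually_all.2 fun i ↦ (hE.smooth i).eventually,
    eventually_eventually_nhds.2 hE.orthonormal] with y h1 h2
  exact ⟨h1, h2⟩

/-- The orthonormal basis of the tangent space given by an orthonormal frame. -/
noncomputable def basis (hE : IsFrame E x) : OrthonormalBasis (Fin m) ℝ (TangentSpace (𝓡 m) x) :=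
  OrthonormalBasis.mk (v := fun i ↦ E i x)
    (orthonormal_iff_ite.2 fun i j ↦ hE.orthonormal.self_of_nhds i j) (by
      have h : LinearIndependent ℝ fun i ↦ E i x :=
        (orthonormal_iff_ite.2 fun i j ↦ hE.orthonormal.self_of_nhds i j).linearIndependent
      have hd : Module.finrank ℝ (TangentSpace (𝓡 m) x) = m :=
        finrank_euclideanSpace_fin (𝕜 := ℝ) (n := m)
      exact (h.span_eq_top_of_card_eq_finrank' (by simp [hd])).ge)

theorem basis_apply (hE : IsFrame E x) (i : Fin m) : hE.basis i = E i x := by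
  simp [basis]

theorem sum_inner_smul (hE : IsFrame E x) (v : TangentSpace (𝓡 m) x) :
    ∑ i, (inner ℝ v (E i x) : ℝ) • E i x = v := by
  have h := hE.basis.sum_repr' v
  simp only [hE.basis_apply] at h
  simpa only [real_inner_comm] using h

theorem sum_metric_smul (hE : IsFrame E x) (X : VF m M) :
    ∑ i, metric X (E i) x • E i x = X x := hE.sum_inner_smul (X x)

theorem eventually_eq_sum (hE : IsFrame E x) (X : VF m M) :
    ∀ᶠ y in 𝓝 x, X y = (∑ i, metric X (E i) • E i : VF m M) y := by
  filter_upwards [hE.eventually] with y hy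
  rw [Finset.sum_apply]
  exact (hy.sum_metric_smul X).symm

theorem metric_sum (hE : IsFrame E x) (c : Fin m → ℝ) (j : Fin m) :
    inner ℝ (∑ i, c i • E i x) (E j x) = c j := by
  have h : ∀ i, inner ℝ (E i x) (E j x) = if i = j then (1 : ℝ) else 0 :=
    fun i ↦ hE.orthonormal.self_of_nhds i j
  simp [sum_inner, real_inner_smul_left, h]

end IsFrame

variable [IsContMDiffRiemannianBundle (𝓡 m) ∞ (EuclideanSpace ℝ (Fin m))
      (fun x : M ↦ TangentSpace (𝓡 m) x)]

section Smooth

variable {X Y Z : VF m M} {f : M → ℝ} {x : M}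

theorem SmoothVF.metric (hX : SmoothVF X x) (hY : SmoothVF Y x) : SmoothFn m (metric X Y) x := by
  filter_upwards [hX, hY] with y hy hy' using hy.inner_bundle hy'

/-- This is how quantities defined through `extend` are transferred to a frame: the frame expansion
of X holds near x and its coefficients are smooth, so they can be pulled out of Φ. -/
theorem IsTensorial.eq_sum {A : Type*} [AddCommGroup A] [Module ℝ A] {Φ : VF m M → A}
    (hΦ : IsTensorial Φ x) {E : Fin m → VF m M} (hE : IsFrame E x) (hX : SmoothVF X x) :
    Φ X = ∑ i, ContactMetric.metric X (E i) x • Φ (E i) := by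
  rw [hΦ.congr hX (hE.eventually_eq_sum X), hΦ.sum]
  · exact Finset.sum_congr rfl fun i _ ↦ hΦ.smul (hX.metric (hE.smooth i)) (hE.smooth i)
  · exact fun i ↦ SmoothVF.smul (hX.metric (hE.smooth i)) (hE.smooth i)

/-- The derivative of a smooth function along a smooth vector field is smooth, if the manifold
carries a unit vector field near the point. -/
theorem SmoothFn.dirDeriv (hf : SmoothFn m f x) (hX : SmoothVF X x) (hZ : SmoothVF Z x)
    (h1 : ∀ᶠ y in 𝓝 x, ContactMetric.metric Z Z y = 1) :
    SmoothFn m (fun y ↦ ContactMetric.dirDeriv f y (X y)) x := by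
  -- The Leibniz rule [X, fZ] = (Xf) Z + f [X, Z], paired with the unit field Z, expresses Xf
  -- through brackets and the metric, whose smoothness is known.
  refine SmoothFn.congr (((hX.bracket (hZ.smul hf)).metric hZ).sub
    (hf.mul ((hX.bracket hZ).metric hZ))) ?_
  filter_upwards [hf.eventually, hZ.eventually, h1] with y hfy hZy h1y
  have h1y' : inner ℝ (Z y) (Z y) = (1 : ℝ) := h1y
  simp only [ContactMetric.metric, bracket_smul_right X hfy hZy, inner_add_left,
    real_inner_smul_left, h1y']
  ring

/-- `[X, Y] f = X (Y f) - Y (X f)`. -/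
theorem dirDeriv_bracket (hf : SmoothFn m f x) (hX : SmoothVF X x) (hY : SmoothVF Y x)
    (hZ : SmoothVF Z x) (h1 : ∀ᶠ y in 𝓝 x, metric Z Z y = 1) :
    dirDeriv f x (bracket X Y x) =
      dirDeriv (fun y ↦ dirDeriv f y (Y y)) x (X x) -
        dirDeriv (fun y ↦ dirDeriv f y (X y)) x (Y x) := by
  have hXf := hf.dirDeriv hX hZ h1
  have hYf := hf.dirDeriv hY hZ h1
  have e : ∀ {W : VF m M}, SmoothVF W x → ∀ᶠ y in 𝓝 x, bracket W (f • Z) y =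
      ((fun y ↦ dirDeriv f y (W y)) • Z + f • bracket W Z) y := fun hW ↦ by
    filter_upwards [hf.eventually, hZ.eventually] with y hfy hZy
    exact bracket_smul_right _ hfy hZy
  -- Both sides of the Jacobi identity for X, Y, fZ are expanded by the Leibniz rule. The terms with
  -- f undifferentiated cancel by the Jacobi identity for X, Y, Z, and the Z-component of the rest
  -- is the claim.
  have h := bracket_jacobi hX hY (hZ.smul hf)
  rw [bracket_congr (X := X) (.of_forall fun _ ↦ rfl) (e hY), bracket_congr (X := Y) (.of_forall fun _ ↦ rfl) (e hX),
    bracket_add_right X (hZ.smul hYf) ((hY.bracket hZ).smul hf),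
    bracket_add_right Y (hZ.smul hXf) ((hX.bracket hZ).smul hf),
    bracket_smul_right _ hYf hZ, bracket_smul_right _ hXf hZ,
    bracket_smul_right _ hf (hY.bracket hZ), bracket_smul_right _ hf (hX.bracket hZ),
    bracket_smul_right _ hf hZ, bracket_jacobi hX hY hZ] at h
  have h' := congrArg (fun v ↦ inner ℝ v (Z x)) h
  have h1y' : inner ℝ (Z x) (Z x) = (1 : ℝ) := h1.self_of_nhds
  simp only [inner_add_left, real_inner_smul_left, h1y'] at h'
  linarith

end Smooth

end Frame

/-! ### The Levi-Civita connection from the Koszul formula -/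

section LeviCivita

variable {m : ℕ} {M : Type*} [TopologicalSpace M] [ChartedSpace (EuclideanSpace ℝ (Fin m)) M]
  [IsManifold (𝓡 m) ∞ M]
  [Bundle.RiemannianBundle (fun x : M ↦ TangentSpace (𝓡 m) x)]
  [IsContMDiffRiemannianBundle (𝓡 m) ∞ (EuclideanSpace ℝ (Fin m))
      (fun x : M ↦ TangentSpace (𝓡 m) x)]

variable {X Y Z W : VF m M} {f : M → ℝ} {x : M} {E : Fin m → VF m M}

theorem koszul_smul_left (hf : SmoothFn m f x) (hX : SmoothVF X x) (hY : SmoothVF Y x)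
    (hZ : SmoothVF Z x) : koszul (f • X) Y Z x = f x * koszul X Y Z x := by
  simp only [koszul, metric_smul_left, metric_smul_right]
  rw [dirDeriv_mul hf (hX.metric hZ), dirDeriv_mul hf (hX.metric hY), Pi.smul_apply',
    dirDeriv_vec_smul]
  simp only [metric, bracket_smul_left _ hf hX, inner_add_left, real_inner_smul_left]
  rw [real_inner_comm (Y x) (X x)]
  ring

theorem koszul_add_left (hX : SmoothVF X x) (hW : SmoothVF W x) (hY : SmoothVF Y x)
    (hZ : SmoothVF Z x) : koszul (X + W) Y Z x = koszul X Y Z x + koszul W Y Z x := by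
  simp only [koszul, metric_add_left, metric_add_right]
  rw [dirDeriv_add (hX.metric hZ) (hW.metric hZ), dirDeriv_add (hX.metric hY) (hW.metric hY),
    Pi.add_apply, dirDeriv_vec_add]
  simp only [metric, bracket_add_left _ hX hW, inner_add_left]
  ring

theorem koszul_smul_mid (hf : SmoothFn m f x) (hX : SmoothVF X x) (hY : SmoothVF Y x)
    (hZ : SmoothVF Z x) :
    koszul X (f • Y) Z x = dirDeriv f x (X x) * metric Y Z x + f x * koszul X Y Z x := by
  simp only [koszul, metric_smul_left, metric_smul_right]
  rw [dirDeriv_mul hf (hY.metric hZ), dirDeriv_mul hf (hX.metric hY), Pi.smul_apply',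
    dirDeriv_vec_smul]
  simp only [metric, bracket_smul_left _ hf hY, bracket_smul_right _ hf hY, inner_add_left,
    real_inner_smul_left]
  rw [real_inner_comm (Y x) (X x)]
  ring

theorem koszul_add_mid (hX : SmoothVF X x) (hY : SmoothVF Y x) (hW : SmoothVF W x)
    (hZ : SmoothVF Z x) : koszul X (Y + W) Z x = koszul X Y Z x + koszul X W Z x := by
  simp only [koszul, metric_add_left, metric_add_right]
  rw [dirDeriv_add (hY.metric hZ) (hW.metric hZ), dirDeriv_add (hX.metric hY) (hX.metric hW),
    Pi.add_apply, dirDeriv_vec_add]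
  simp only [metric, bracket_add_left _ hY hW, bracket_add_right _ hY hW, inner_add_left]
  ring

theorem isTensorial_koszul (hX : SmoothVF X x) (hY : SmoothVF Y x) :
    IsTensorial (fun Z ↦ koszul X Y Z x) x where
  smul {f Z} hf hZ := by
    simp only [koszul, metric_smul_right]
    rw [dirDeriv_mul hf (hX.metric hZ), dirDeriv_mul hf (hY.metric hZ), Pi.smul_apply',
      dirDeriv_vec_smul]
    simp only [metric, bracket_smul_right _ hf hZ, inner_add_left, real_inner_smul_left,
      smul_eq_mul]
    rw [real_inner_comm (X x) (Z x), real_inner_comm (Y x) (Z x)]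
    ring
  add {Z W} hZ hW := by
    simp only [koszul, metric_add_right]
    rw [dirDeriv_add (hX.metric hZ) (hX.metric hW), dirDeriv_add (hY.metric hZ) (hY.metric hW),
      Pi.add_apply, dirDeriv_vec_add]
    simp only [metric, bracket_add_right _ hZ hW, inner_add_left]
    ring

theorem SmoothFn.koszul (hE : IsFrame E x) (i : Fin m) (hX : SmoothVF X x) (hY : SmoothVF Y x)
    (hZ : SmoothVF Z x) : SmoothFn m (koszul X Y Z) x := by
  have h1 : ∀ᶠ y in 𝓝 x, ContactMetric.metric (E i) (E i) y = 1 := by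
    filter_upwards [hE.orthonormal] with y hy
    simp [hy]
  refine (SmoothFn.const (1 / 2) x).mul ?_
  exact ((((((hY.metric hZ).dirDeriv hX (hE.smooth i) h1).add
    ((hX.metric hZ).dirDeriv hY (hE.smooth i) h1)).sub
    ((hX.metric hY).dirDeriv hZ (hE.smooth i) h1)).add
    ((hX.bracket hY).metric hZ)).sub ((hX.bracket hZ).metric hY)).sub ((hY.bracket hZ).metric hX)

theorem sum_inner_onb_smul (v : TangentSpace (𝓡 m) x) :
    ∑ i, (inner ℝ v (onb x i) : ℝ) • onb x i = v := by
  simpa only [real_inner_comm] using (onb x).sum_repr' v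

/-- The basis `onb x` is chosen separately at each point, so the definition of `nabla` shows no
regularity in x. Tensoriality of the Koszul expression in its last slot allows a smooth frame
instead, and smoothness of ∇_X Y follows. -/
theorem nabla_eq_sum (hE : IsFrame E x) (hX : SmoothVF X x) (hY : SmoothVF Y x) :
    nabla X Y x = ∑ i, koszul X Y (E i) x • E i x := by
  have h : ∀ k, koszul X Y (extend (onb x k)) x =
      ∑ i, inner ℝ (onb x k) (E i x) * koszul X Y (E i) x := fun k ↦ by
    rw [(isTensorial_koszul hX hY).eq_sum hE (SmoothVF.extend _)]
    simp only [metric, extend_self, smul_eq_mul]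
  simp only [nabla, h, Finset.sum_smul, mul_comm, mul_smul]
  rw [Finset.sum_comm]
  refine Finset.sum_congr rfl fun i _ ↦ ?_
  rw [← Finset.smul_sum]
  congr 1
  simpa only [real_inner_comm] using sum_inner_onb_smul (E i x)

theorem nabla_smul_left (hf : SmoothFn m f x) (hX : SmoothVF X x) (hY : SmoothVF Y x) :
    nabla (f • X) Y x = f x • nabla X Y x := by
  simp only [nabla, koszul_smul_left hf hX hY (SmoothVF.extend _), Finset.smul_sum, mul_smul]

theorem nabla_add_left (hX : SmoothVF X x) (hW : SmoothVF W x) (hY : SmoothVF Y x) :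
    nabla (X + W) Y x = nabla X Y x + nabla W Y x := by
  simp only [nabla, koszul_add_left hX hW hY (SmoothVF.extend _), add_smul, Finset.sum_add_distrib]

theorem isTensorial_nabla (hY : SmoothVF Y x) : IsTensorial (fun X ↦ nabla X Y x) x where
  smul hf hX := nabla_smul_left hf hX hY
  add hX hW := nabla_add_left hX hW hY

theorem nabla_smul_right (hf : SmoothFn m f x) (hX : SmoothVF X x) (hY : SmoothVF Y x) :
    nabla X (f • Y) x = dirDeriv f x (X x) • Y x + f x • nabla X Y x := by
  simp only [nabla, koszul_smul_mid hf hX hY (SmoothVF.extend _), add_smul,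
    Finset.sum_add_distrib, Finset.smul_sum, mul_smul, metric, extend_self]
  rw [← Finset.smul_sum, sum_inner_onb_smul]

theorem nabla_add_right (hX : SmoothVF X x) (hY : SmoothVF Y x) (hW : SmoothVF W x) :
    nabla X (Y + W) x = nabla X Y x + nabla X W x := by
  simp only [nabla, koszul_add_mid hX hY hW (SmoothVF.extend _), add_smul, Finset.sum_add_distrib]

theorem nabla_congr_right (h : ∀ᶠ y in 𝓝 x, Y y = W y) : nabla X Y x = nabla X W x := by
  have h1 : ∀ Z : VF m M, metric Y Z =ᶠ[𝓝 x] metric W Z := fun Z ↦ by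
    filter_upwards [h] with y hy; simp only [metric, hy]
  have h2 : metric X Y =ᶠ[𝓝 x] metric X W := by
    filter_upwards [h] with y hy; simp only [metric, hy]
  have h3 : bracket X Y x = bracket X W x := bracket_congr (.of_forall fun _ ↦ rfl) h
  have h4 : ∀ Z, bracket Y Z x = bracket W Z x := fun Z ↦
    bracket_congr h (.of_forall fun _ ↦ rfl)
  have h5 : ∀ Z : VF m M, metric (bracket X Y) Z x = metric (bracket X W) Z x := fun Z ↦ by
    simp only [metric, h3]
  have h6 : ∀ Z : VF m M, metric (bracket Y Z) X x = metric (bracket W Z) X x := fun Z ↦ by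
    simp only [metric, h4]
  have h7 : ∀ Z : VF m M, metric Z Y x = metric Z W x := fun Z ↦ by
    simp only [metric, h.self_of_nhds]
  simp only [nabla, koszul, dirDeriv_congr (h1 _), dirDeriv_congr h2, h5, h6, h7, h.self_of_nhds]

theorem SmoothVF.nabla (hE : IsFrame E x) (hX : SmoothVF X x) (hY : SmoothVF Y x) :
    SmoothVF (nabla X Y) x := by
  refine SmoothVF.congr (Y := ContactMetric.nabla X Y)
    (SmoothVF.sum Finset.univ fun i ↦ SmoothVF.smul
      (SmoothFn.koszul hE i hX hY (hE.smooth i)) (hE.smooth i)) ?_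
  filter_upwards [hE.eventually, hX.eventually, hY.eventually] with y hEy hXy hYy
  rw [nabla_eq_sum hEy hXy hYy, Finset.sum_apply]
  rfl

theorem nabla_sum_right (hX : SmoothVF X x) {ι : Type*} (s : Finset ι) {V : ι → VF m M}
    (hV : ∀ i, SmoothVF (V i) x) : nabla X (∑ i ∈ s, V i) x = ∑ i ∈ s, nabla X (V i) x := by
  classical
  induction s using Finset.induction_on with
  | empty =>
    have h := nabla_smul_right (SmoothFn.const 0 x) hX (SmoothVF.sum (∅ : Finset ι) hV)
    have h0 : (fun _ : M ↦ (0 : ℝ)) • (∑ i ∈ (∅ : Finset ι), V i) = 0 := by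
      funext y; exact zero_smul ℝ _
    rw [h0, dirDeriv_const, zero_smul, zero_smul, zero_add] at h
    simpa only [Finset.sum_empty] using h
  | insert a s ha h =>
    rw [Finset.sum_insert ha, Finset.sum_insert ha,
      nabla_add_right hX (hV a) (SmoothVF.sum s hV), h]

end LeviCivita

/-! ### Tensoriality of the curvature; Ricci and scalar curvature in a frame -/

section Curvature

variable {m : ℕ} {M : Type*} [TopologicalSpace M] [ChartedSpace (EuclideanSpace ℝ (Fin m)) M]
  [IsManifold (𝓡 m) ∞ M]
  [Bundle.RiemannianBundle (fun x : M ↦ TangentSpace (𝓡 m) x)]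
  [IsContMDiffRiemannianBundle (𝓡 m) ∞ (EuclideanSpace ℝ (Fin m))
      (fun x : M ↦ TangentSpace (𝓡 m) x)]

variable {X Y Z W : VF m M} {f : M → ℝ} {x : M} {E : Fin m → VF m M}

theorem curvatureVF_apply (X Y Z : VF m M) (x : M) : curvatureVF X Y Z x =
    nabla X (nabla Y Z) x - nabla Y (nabla X Z) x - nabla (bracket X Y) Z x := rfl

theorem IsFrame.smoothFn_dirDeriv (hE : IsFrame E x) (i : Fin m) (hf : SmoothFn m f x)
    (hX : SmoothVF X x) : SmoothFn m (fun y ↦ dirDeriv f y (X y)) x :=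
  hf.dirDeriv hX (hE.smooth i) (by filter_upwards [hE.orthonormal] with y hy; simp [hy])

theorem IsFrame.dirDeriv_bracket (hE : IsFrame E x) (i : Fin m) (hf : SmoothFn m f x)
    (hX : SmoothVF X x) (hY : SmoothVF Y x) :
    dirDeriv f x (bracket X Y x) =
      dirDeriv (fun y ↦ dirDeriv f y (Y y)) x (X x) -
        dirDeriv (fun y ↦ dirDeriv f y (X y)) x (Y x) :=
  ContactMetric.dirDeriv_bracket hf hX hY (hE.smooth i)
    (by filter_upwards [hE.orthonormal] with y hy; simp [hy])

theorem curvatureVF_swap (hX : SmoothVF X x) (hY : SmoothVF Y x) (hZ : SmoothVF Z x) :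
    curvatureVF X Y Z x = -curvatureVF Y X Z x := by
  have h : bracket X Y = (fun _ : M ↦ (-1 : ℝ)) • bracket Y X := by
    rw [bracket_swap X Y]; funext y; simp [Pi.smul_apply']
  rw [curvatureVF_apply, curvatureVF_apply, h,
    nabla_smul_left (SmoothFn.const _ x) (hY.bracket hX) hZ]
  module

/-- The term (Yf) ∇_X Z produced by ∇_Y(f ∇_X Z) cancels against the one coming from [fX, Y] = f [X,
Y] - (Yf) X. -/
theorem isTensorial_curvatureVF_left (hE : IsFrame E x) (i : Fin m) (hY : SmoothVF Y x)
    (hZ : SmoothVF Z x) : IsTensorial (fun X ↦ curvatureVF X Y Z x) x where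
  smul {f X} hf hX := by
    have h1 : nabla Y (nabla (f • X) Z) x = nabla Y (f • nabla X Z) x :=
      nabla_congr_right (by
        filter_upwards [hf.eventually, hX.eventually, hZ.eventually] with y h1 h2 h3
        exact nabla_smul_left h1 h2 h3)
    have hYf := hE.smoothFn_dirDeriv i hf hY
    have h2 : nabla (bracket (f • X) Y) Z x =
        nabla ((fun y ↦ -dirDeriv f y (Y y)) • X + f • bracket X Y) Z x :=
      (isTensorial_nabla hZ).congr ((hX.smul hf).bracket hY) (by
        filter_upwards [hf.eventually, hX.eventually] with y h1 h2
        exact bracket_smul_left Y h1 h2)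
    simp only [curvatureVF_apply]
    rw [h1, h2, nabla_smul_left hf hX (hY.nabla hE hZ), nabla_smul_right hf hY (hX.nabla hE hZ),
      nabla_add_left (hX.smul hYf.neg) ((hX.bracket hY).smul hf) hZ,
      nabla_smul_left hYf.neg hX hZ, nabla_smul_left hf (hX.bracket hY) hZ]
    module
  add {X W} hX hW := by
    have h1 : nabla Y (nabla (X + W) Z) x = nabla Y (nabla X Z + nabla W Z) x :=
      nabla_congr_right (by
        filter_upwards [hX.eventually, hW.eventually, hZ.eventually] with y h1 h2 h3
        exact nabla_add_left h1 h2 h3)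
    have h2 : nabla (bracket (X + W) Y) Z x = nabla (bracket X Y + bracket W Y) Z x :=
      (isTensorial_nabla hZ).congr ((hX.add hW).bracket hY) (by
        filter_upwards [hX.eventually, hW.eventually] with y h1 h2
        exact bracket_add_left Y h1 h2)
    simp only [curvatureVF_apply]
    rw [h1, h2, nabla_add_left hX hW (hY.nabla hE hZ),
      nabla_add_right hY (hX.nabla hE hZ) (hW.nabla hE hZ),
      nabla_add_left (hX.bracket hY) (hW.bracket hY) hZ]
    module

theorem isTensorial_curvatureVF_mid (hE : IsFrame E x) (i : Fin m) (hX : SmoothVF X x)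
    (hZ : SmoothVF Z x) : IsTensorial (fun Y ↦ curvatureVF X Y Z x) x where
  smul {f Y} hf hY := by
    rw [curvatureVF_swap hX (hY.smul hf) hZ, curvatureVF_swap hX hY hZ,
      (isTensorial_curvatureVF_left hE i hX hZ).smul hf hY, smul_neg]
  add {Y W} hY hW := by
    rw [curvatureVF_swap hX (hY.add hW) hZ, curvatureVF_swap hX hY hZ, curvatureVF_swap hX hW hZ,
      (isTensorial_curvatureVF_left hE i hX hZ).add hY hW, neg_add]

/-- The mixed first-order terms are symmetric in X and Y and drop out. The second derivatives of f
leave (XYf - YXf) Z, which cancels ([X, Y]f) Z from the last term. -/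
theorem isTensorial_curvatureVF_right (hE : IsFrame E x) (i : Fin m) (hX : SmoothVF X x)
    (hY : SmoothVF Y x) : IsTensorial (fun Z ↦ curvatureVF X Y Z x) x where
  smul {f Z} hf hZ := by
    have h : ∀ {V W : VF m M}, SmoothVF V x → SmoothVF W x → nabla W (nabla V (f • Z)) x =
        dirDeriv (fun y ↦ dirDeriv f y (V y)) x (W x) • Z x + dirDeriv f x (V x) • nabla W Z x
          + (dirDeriv f x (W x) • nabla V Z x + f x • nabla W (nabla V Z) x) := fun {V W} hV hW ↦ by
      have hVf := hE.smoothFn_dirDeriv i hf hV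
      rw [nabla_congr_right (W := (fun y ↦ dirDeriv f y (V y)) • Z + f • nabla V Z),
        nabla_add_right hW (hZ.smul hVf) ((hV.nabla hE hZ).smul hf), nabla_smul_right hVf hW hZ,
        nabla_smul_right hf hW (hV.nabla hE hZ)]
      filter_upwards [hf.eventually, hV.eventually, hZ.eventually] with y h1 h2 h3
      exact nabla_smul_right h1 h2 h3
    simp only [curvatureVF_apply]
    rw [h hX hY, h hY hX, nabla_smul_right hf (hX.bracket hY) hZ, hE.dirDeriv_bracket i hf hX hY]
    module
  add {Z W} hZ hW := by
    have h : ∀ {V U : VF m M}, SmoothVF V x → SmoothVF U x → nabla U (nabla V (Z + W)) x =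
        nabla U (nabla V Z) x + nabla U (nabla V W) x := fun {V U} hV hU ↦ by
      rw [nabla_congr_right (W := nabla V Z + nabla V W),
        nabla_add_right hU (hV.nabla hE hZ) (hV.nabla hE hW)]
      filter_upwards [hV.eventually, hZ.eventually, hW.eventually] with y h1 h2 h3
      exact nabla_add_right h1 h2 h3
    simp only [curvatureVF_apply]
    rw [h hX hY, h hY hX, nabla_add_right (hX.bracket hY) hZ hW]
    module

theorem curvature_eq_sum (hE : IsFrame E x) (u v w : TangentSpace (𝓡 m) x) :
    curvature u v w = ∑ i, ∑ j, ∑ k, (inner ℝ u (E i x) * inner ℝ v (E j x) * inner ℝ w (E k x)) •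
      curvatureVF (E i) (E j) (E k) x := by
  -- Tensoriality of the curvature was proved with the help of one unit field of the frame, which
  -- does not exist when m = 0; there the tangent space is trivial.
  rcases isEmpty_or_nonempty (Fin m) with h | ⟨⟨i₀⟩⟩
  · have : Subsingleton (TangentSpace (𝓡 m) x) :=
      hE.basis.toBasis.repr.toEquiv.injective.subsingleton
    exact Subsingleton.elim _ _
  have hu := SmoothVF.extend u
  have hv := SmoothVF.extend v
  have hw := SmoothVF.extend w
  rw [curvature, (isTensorial_curvatureVF_left hE i₀ hv hw).eq_sum hE hu]
  refine Finset.sum_congr rfl fun i _ ↦ ?_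
  rw [(isTensorial_curvatureVF_mid hE i₀ (hE.smooth i) hw).eq_sum hE hv, Finset.smul_sum]
  refine Finset.sum_congr rfl fun j _ ↦ ?_
  rw [(isTensorial_curvatureVF_right hE i₀ (hE.smooth i) (hE.smooth j)).eq_sum hE hw,
    Finset.smul_sum, Finset.smul_sum]
  refine Finset.sum_congr rfl fun k _ ↦ ?_
  simp only [metric, extend_self, smul_smul, mul_assoc]

theorem ricci_eq_sum (hE : IsFrame E x) (v w : TangentSpace (𝓡 m) x) :
    ricci v w = ∑ j, ∑ k, inner ℝ v (E j x) * inner ℝ w (E k x) *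
      ∑ i, metric (curvatureVF (E i) (E j) (E k)) (E i) x := by
  have h : ∀ i j k, ∑ a, inner ℝ (onb x a) (E i x) *
      inner ℝ (curvatureVF (E i) (E j) (E k) x) (onb x a) =
        metric (curvatureVF (E i) (E j) (E k)) (E i) x := fun i j k ↦ by
    rw [metric, ← (onb x).sum_inner_mul_inner]
    exact Finset.sum_congr rfl fun a _ ↦ mul_comm _ _
  simp only [ricci, curvature_eq_sum hE, sum_inner, real_inner_smul_left]
  rw [Finset.sum_comm]
  simp only [Finset.sum_comm (s := Finset.univ (α := Fin (Module.finrank ℝ _)))]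
  simp only [← h, Finset.mul_sum]
  rw [Finset.sum_comm]
  refine Finset.sum_congr rfl fun j _ ↦ ?_
  rw [Finset.sum_comm]
  refine Finset.sum_congr rfl fun k _ ↦ Finset.sum_congr rfl fun i _ ↦
    Finset.sum_congr rfl fun a _ ↦ ?_
  ring

theorem ricci_frame (hE : IsFrame E x) (j k : Fin m) :
    ricci (E j x) (E k x) = ∑ i, metric (curvatureVF (E i) (E j) (E k)) (E i) x := by
  have h : ∀ i j, inner ℝ (E i x) (E j x) = if i = j then (1 : ℝ) else 0 :=
    fun i j ↦ hE.orthonormal.self_of_nhds i j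
  rw [ricci_eq_sum hE]
  simp [h]

theorem scalarCurvature_eq_sum (hE : IsFrame E x) :
    scalarCurvature m x = ∑ j, ricci (E j x) (E j x) := by
  have h : ∀ i j, ∑ a, inner ℝ (onb x a) (E i x) * inner ℝ (onb x a) (E j x) =
      if i = j then (1 : ℝ) else 0 := fun i j ↦ by
    rw [← hE.orthonormal.self_of_nhds i j, metric, ← (onb x).sum_inner_mul_inner]
    exact Finset.sum_congr rfl fun a _ ↦ by rw [real_inner_comm (onb x a) (E i x)]
  have h' : ∀ a, ricci (onb x a) (onb x a) = ∑ j, ∑ k, inner ℝ (onb x a) (E j x) *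
      inner ℝ (onb x a) (E k x) * ricci (E j x) (E k x) := fun a ↦ by
    simp only [ricci_frame hE]; exact ricci_eq_sum hE _ _
  simp only [scalarCurvature, h']
  rw [Finset.sum_comm]
  refine Finset.sum_congr rfl fun j _ ↦ ?_
  rw [Finset.sum_comm]
  simp [← Finset.sum_mul, h]

end Curvature

/-! ### Connection, curvature and Jacobi identity in terms of structure functions -/

section StructureFunctions

variable {m : ℕ} {M : Type*} [TopologicalSpace M] [ChartedSpace (EuclideanSpace ℝ (Fin m)) M]
  [IsManifold (𝓡 m) ∞ M]
  [Bundle.RiemannianBundle (fun x : M ↦ TangentSpace (𝓡 m) x)]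
  [IsContMDiffRiemannianBundle (𝓡 m) ∞ (EuclideanSpace ℝ (Fin m))
      (fun x : M ↦ TangentSpace (𝓡 m) x)]

variable {f : M → ℝ} {x : M} {E : Fin m → VF m M}

/-- The structure functions `g([E i, E j], E k)` of a frame. -/
noncomputable def structFn (E : Fin m → VF m M) (i j k : Fin m) : M → ℝ :=
  metric (bracket (E i) (E j)) (E k)

/-- The connection coefficients `g(∇_{E i} E j, E k)` of an orthonormal frame, in terms of its
structure functions. -/
noncomputable def connFn (E : Fin m → VF m M) (i j k : Fin m) (y : M) : ℝ :=
  (1 / 2) * (structFn E i j k y - structFn E i k j y - structFn E j k i y)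

theorem structFn_swap (E : Fin m → VF m M) (i j k : Fin m) (y : M) :
    structFn E i j k y = -structFn E j i k y := by
  rw [structFn, bracket_swap, metric_neg_left, structFn]

namespace IsFrame

theorem smoothFn_structFn (hE : IsFrame E x) (i j k : Fin m) : SmoothFn m (structFn E i j k) x :=
  ((hE.smooth i).bracket (hE.smooth j)).metric (hE.smooth k)

theorem smoothFn_connFn (hE : IsFrame E x) (i j k : Fin m) : SmoothFn m (connFn E i j k) x :=
  (SmoothFn.const _ x).mul (((hE.smoothFn_structFn i j k).sub (hE.smoothFn_structFn i k j)).sub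
    (hE.smoothFn_structFn j k i))

theorem bracket_eq (hE : IsFrame E x) (i j : Fin m) :
    bracket (E i) (E j) x = ∑ k, structFn E i j k x • E k x :=
  (hE.sum_metric_smul _).symm

/-- The inner products of frame vectors are locally constant, so only the three bracket terms of the
Koszul formula survive. -/
theorem koszul_eq (hE : IsFrame E x) (i j k : Fin m) :
    koszul (E i) (E j) (E k) x = connFn E i j k x := by
  have h : ∀ i j (v : TangentSpace (𝓡 m) x), dirDeriv (metric (E i) (E j)) x v = 0 :=
    fun i j v ↦ by
      rw [dirDeriv_congr (g := fun _ ↦ if i = j then 1 else 0), dirDeriv_const]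
      filter_upwards [hE.orthonormal] with y hy using hy i j
  simp only [koszul, h, connFn, structFn]
  ring

theorem nabla_eq (hE : IsFrame E x) (i j : Fin m) :
    nabla (E i) (E j) x = ∑ k, connFn E i j k x • E k x := by
  simp only [nabla_eq_sum hE (hE.smooth i) (hE.smooth j), hE.koszul_eq]

theorem nabla_nabla_eq (hE : IsFrame E x) (i j k : Fin m) :
    nabla (E i) (nabla (E j) (E k)) x =
      ∑ l, (dirDeriv (connFn E j k l) x (E i x) +
        ∑ n, connFn E j k n x * connFn E i n l x) • E l x := by
  rw [nabla_congr_right (W := ∑ l, connFn E j k l • E l),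
    nabla_sum_right (hE.smooth i) _
      (fun l ↦ (hE.smooth l).smul (hE.smoothFn_connFn j k l))]
  · simp only [nabla_smul_right (hE.smoothFn_connFn j k _) (hE.smooth i) (hE.smooth _),
      hE.nabla_eq, Finset.sum_add_distrib, add_smul, Finset.smul_sum, smul_smul, Finset.sum_smul]
    rw [Finset.sum_comm (f := fun l n ↦ (connFn E j k l x * connFn E i l n x) • E n x)]
  · filter_upwards [hE.eventually] with y hy
    rw [hy.nabla_eq, Finset.sum_apply]
    rfl

theorem nabla_bracket_eq (hE : IsFrame E x) (i j k : Fin m) :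
    nabla (bracket (E i) (E j)) (E k) x =
      ∑ l, (∑ n, structFn E i j n x * connFn E n k l x) • E l x := by
  rw [(isTensorial_nabla (hE.smooth k)).eq_sum hE ((hE.smooth i).bracket (hE.smooth j))]
  simp only [hE.nabla_eq, Finset.smul_sum, smul_smul, Finset.sum_smul]
  rw [Finset.sum_comm]
  rfl

/-- The components of the curvature tensor in an orthonormal frame. -/
theorem metric_curvatureVF (hE : IsFrame E x) (i j k l : Fin m) :
    metric (curvatureVF (E i) (E j) (E k)) (E l) x =
      dirDeriv (connFn E j k l) x (E i x) - dirDeriv (connFn E i k l) x (E j x) +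
        ∑ n, (connFn E j k n x * connFn E i n l x - connFn E i k n x * connFn E j n l x
          - structFn E i j n x * connFn E n k l x) := by
  simp only [metric, curvatureVF_apply, inner_sub_left]
  rw [hE.nabla_nabla_eq, hE.nabla_nabla_eq, hE.nabla_bracket_eq, hE.metric_sum, hE.metric_sum,
    hE.metric_sum]
  simp only [Finset.sum_sub_distrib]
  ring

theorem dirDeriv_connFn (hE : IsFrame E x) (i j k : Fin m) (v : TangentSpace (𝓡 m) x) :
    dirDeriv (connFn E i j k) x v = (1 / 2) * (dirDeriv (structFn E i j k) x v
      - dirDeriv (structFn E i k j) x v - dirDeriv (structFn E j k i) x v) := by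
  have h := dirDeriv_mul (SmoothFn.const (1 / 2) x) (((hE.smoothFn_structFn i j k).sub
    (hE.smoothFn_structFn i k j)).sub (hE.smoothFn_structFn j k i)) v
  rw [dirDeriv_const, mul_zero, add_zero, dirDeriv_sub ((hE.smoothFn_structFn i j k).sub
    (hE.smoothFn_structFn i k j)) (hE.smoothFn_structFn j k i), dirDeriv_sub
    (hE.smoothFn_structFn i j k) (hE.smoothFn_structFn i k j)] at h
  exact h

theorem metric_bracket_bracket (hE : IsFrame E x) (i j k l : Fin m) :
    metric (bracket (E i) (bracket (E j) (E k))) (E l) x =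
      dirDeriv (structFn E j k l) x (E i x) + ∑ n, structFn E j k n x * structFn E i n l x := by
  have hs : ∀ (s : Finset (Fin m)), bracket (E i) (∑ n ∈ s, structFn E j k n • E n) x =
      ∑ n ∈ s, (dirDeriv (structFn E j k n) x (E i x) • E n x +
        structFn E j k n x • bracket (E i) (E n) x) := fun s ↦ by
    have hV := fun n ↦ (hE.smooth n).smul (hE.smoothFn_structFn j k n)
    induction s using Finset.induction_on with
    | empty => exact congrFun VectorField.mlieBracket_zero_right x
    | insert a s ha h =>
      rw [Finset.sum_insert ha, Finset.sum_insert ha, bracket_add_right _ (hV a)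
        (SmoothVF.sum s hV), h, bracket_smul_right _ (hE.smoothFn_structFn j k a) (hE.smooth a)]
  have h : bracket (E i) (bracket (E j) (E k)) x =
      ∑ n, (dirDeriv (structFn E j k n) x (E i x) +
        ∑ l, structFn E j k l x * structFn E i l n x) • E n x := by
    rw [bracket_congr (X' := E i) (Y' := ∑ n, structFn E j k n • E n)
      (.of_forall fun _ ↦ rfl) (hE.eventually_eq_sum _), hs]
    simp only [hE.bracket_eq, Finset.sum_add_distrib, add_smul, Finset.smul_sum, smul_smul,
      Finset.sum_smul]
    rw [Finset.sum_comm (f := fun l n ↦ (structFn E j k l x * structFn E i l n x) • E n x)]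
  rw [metric, h, hE.metric_sum]

/-- The Jacobi identity in terms of the structure functions of a frame. -/
theorem jacobi (hE : IsFrame E x) (i j k l : Fin m) :
    dirDeriv (structFn E j k l) x (E i x) + dirDeriv (structFn E k i l) x (E j x)
      + dirDeriv (structFn E i j l) x (E k x)
      + ∑ n, (structFn E j k n x * structFn E i n l x + structFn E k i n x * structFn E j n l x
        + structFn E i j n x * structFn E k n l x) = 0 := by
  have h := bracket_jacobi (hE.smooth i) (hE.smooth j) (hE.smooth k)
  rw [bracket_swap (bracket (E i) (E j)) (E k), bracket_congr (X := E j) (X' := E j)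
    (Y' := (fun _ : M ↦ (-1 : ℝ)) • bracket (E k) (E i)) (.of_forall fun _ ↦ rfl)
    (.of_forall fun y ↦ by rw [bracket_swap]; simp [Pi.smul_apply']),
    bracket_smul_right _ (SmoothFn.const _ x) ((hE.smooth k).bracket (hE.smooth i)),
    dirDeriv_const, zero_smul, zero_add] at h
  have h' := congrArg (fun v ↦ inner ℝ v (E l x)) h
  simp only [inner_add_left, Pi.neg_apply, inner_neg_left, real_inner_smul_left] at h'
  have e := hE.metric_bracket_bracket
  simp only [metric] at e
  rw [e, e, e] at h'
  simp only [Finset.sum_add_distrib]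
  linarith

/-- Commutation of iterated derivatives along the vectors of a frame. -/
theorem dirDeriv_comm (hE : IsFrame E x) (hf : SmoothFn m f x) (i j : Fin m) :
    dirDeriv (fun y ↦ dirDeriv f y (E j y)) x (E i x) -
      dirDeriv (fun y ↦ dirDeriv f y (E i y)) x (E j x) =
        ∑ k, structFn E i j k x * dirDeriv f x (E k x) := by
  rw [← hE.dirDeriv_bracket i hf (hE.smooth i) (hE.smooth j), hE.bracket_eq]
  simp only [dirDeriv, map_sum, map_smul, smul_eq_mul]

end IsFrame

end StructureFunctions

/-! ### The tensor h and the exterior derivative of η in a frame -/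

section HTensor

variable {m : ℕ} {M : Type*} [TopologicalSpace M] [ChartedSpace (EuclideanSpace ℝ (Fin m)) M]
  [IsManifold (𝓡 m) ∞ M]
  [Bundle.RiemannianBundle (fun x : M ↦ TangentSpace (𝓡 m) x)]
  [IsContMDiffRiemannianBundle (𝓡 m) ∞ (EuclideanSpace ℝ (Fin m))
      (fun x : M ↦ TangentSpace (𝓡 m) x)]

variable {X Y : VF m M} {f : M → ℝ} {x : M} {E : Fin m → VF m M}
  {φ : EndField m M} {ξ : VF m M} {η : OneForm m M}

theorem IsTensorial.pointwise {A : Type*} [AddCommGroup A] [Module ℝ A] {Φ : VF m M → A}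
    (hΦ : IsTensorial Φ x) (hE : IsFrame E x) (hX : SmoothVF X x) (hY : SmoothVF Y x)
    (h : X x = Y x) : Φ X = Φ Y := by
  rw [hΦ.eq_sum hE hX, hΦ.eq_sum hE hY]
  simp only [metric, h]

namespace IsContactMetric

theorem smoothVF_xi (hM : IsContactMetric φ ξ η) (x : M) : SmoothVF ξ x :=
  Eventually.of_forall fun y ↦ hM.smooth_xi y

theorem smoothVF_phi (hM : IsContactMetric φ ξ η) (hX : SmoothVF X x) :
    SmoothVF (fun y ↦ φ y (X y)) x := by
  filter_upwards [hX] with y hy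
  exact (hM.smooth_phi y).clm_bundle_apply hy

theorem eta_apply (hM : IsContactMetric φ ξ η) (X : VF m M) :
    (fun y ↦ η y (X y)) = metric ξ X := by
  funext y; exact hM.eta_eq y _

theorem inner_xi_xi (hM : IsContactMetric φ ξ η) (x : M) : inner ℝ (ξ x) (ξ x) = (1 : ℝ) := by
  rw [← hM.eta_eq, hM.eta_xi]

/-- The operation `V ↦ (1/2) (L_ξ φ) V` on vector fields is tensorial. -/
theorem isTensorial_h (hM : IsContactMetric φ ξ η) (x : M) :
    IsTensorial (fun V : VF m M ↦ (1 / 2 : ℝ) • (bracket ξ (fun y ↦ φ y (V y)) x -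
      φ x (bracket ξ V x))) x where
  smul {f V} hf hV := by
    -- The two terms in which f is differentiated are both (ξf) φV and cancel.
    have h : (fun y ↦ φ y ((f • V) y)) = f • (fun y ↦ φ y (V y) : VF m M) := by
      funext y; exact map_smul (φ y) (f y) (V y)
    rw [h, bracket_smul_right _ hf (hM.smoothVF_phi hV), bracket_smul_right _ hf hV, map_add,
      map_smul, map_smul]
    module
  add {V W} hV hW := by
    have h : (fun y ↦ φ y ((V + W) y)) =
        (fun y ↦ φ y (V y) : VF m M) + (fun y ↦ φ y (W y) : VF m M) := by
      funext y; exact map_add (φ y) (V y) (W y)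
    rw [h, bracket_add_right _ (hM.smoothVF_phi hV) (hM.smoothVF_phi hW),
      bracket_add_right _ hV hW, map_add]
    module

theorem hTensor_eq_sum (hM : IsContactMetric φ ξ η) (hE : IsFrame E x)
    (v : TangentSpace (𝓡 m) x) :
    hTensor φ ξ x v = ∑ i, (inner ℝ v (E i x) : ℝ) • ((1 / 2 : ℝ) •
      (bracket ξ (fun y ↦ φ y (E i y)) x - φ x (bracket ξ (E i) x))) := by
  rw [hTensor, (hM.isTensorial_h x).eq_sum hE (SmoothVF.extend v)]
  simp only [metric, extend_self]

theorem hTensor_frame (hM : IsContactMetric φ ξ η) (hE : IsFrame E x) (i : Fin m) :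
    hTensor φ ξ x (E i x) = (1 / 2 : ℝ) •
      (bracket ξ (fun y ↦ φ y (E i y)) x - φ x (bracket ξ (E i) x)) :=
  (hM.isTensorial_h x).pointwise hE (SmoothVF.extend _) (hE.smooth i) (extend_self _)

theorem trHSq_eq_sum (hM : IsContactMetric φ ξ η) (hE : IsFrame E x) :
    trHSq φ ξ x = ∑ i, ∑ j, inner ℝ (hTensor φ ξ x (E i x)) (E j x) *
      inner ℝ (hTensor φ ξ x (E j x)) (E i x) := by
  have h : ∀ v, hTensor φ ξ x v = ∑ i, (inner ℝ v (E i x) : ℝ) • hTensor φ ξ x (E i x) := fun v ↦ by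
    simp only [hM.hTensor_frame hE]; exact hM.hTensor_eq_sum hE v
  have h2 : ∀ v, inner ℝ (hTensor φ ξ x (hTensor φ ξ x v)) v =
      ∑ i, ∑ j, inner ℝ v (E i x) * (inner ℝ (hTensor φ ξ x (E i x)) (E j x) *
        inner ℝ (hTensor φ ξ x (E j x)) v) := fun v ↦ by
    rw [h (hTensor φ ξ x v), h v]
    simp only [sum_inner, real_inner_smul_left, Finset.sum_mul]
    rw [Finset.sum_comm]
    simp only [mul_assoc]
  simp only [trHSq, h2]
  rw [Finset.sum_comm]
  refine Finset.sum_congr rfl fun i _ ↦ ?_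
  rw [Finset.sum_comm]
  refine Finset.sum_congr rfl fun j _ ↦ ?_
  rw [← (onb x).sum_inner_mul_inner (hTensor φ ξ x (E j x)) (E i x), Finset.mul_sum]
  exact Finset.sum_congr rfl fun a _ ↦ by ring


/-- `dη(X, Y)` may be computed with arbitrary smooth extensions. -/
theorem extDeriv_frame (hM : IsContactMetric φ ξ η) (hE : IsFrame E x) (i j : Fin m) :
    extDeriv η x (E i x) (E j x) = (1 / 2) * (dirDeriv (metric ξ (E j)) x (E i x)
      - dirDeriv (metric ξ (E i)) x (E j x) - metric ξ (bracket (E i) (E j)) x) := by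
  have hξ := hM.smoothVF_xi x
  have h1 : ∀ {X : VF m M}, SmoothVF X x → IsTensorial (fun Y ↦
      dirDeriv (metric ξ Y) x (X x) - dirDeriv (metric ξ X) x (Y x)
        - metric ξ (bracket X Y) x) x := fun {X} hX ↦
    { smul := fun {f Y} hf hY ↦ by
        rw [metric_smul_right, dirDeriv_mul hf (hξ.metric hY), Pi.smul_apply', dirDeriv_vec_smul]
        simp only [metric, bracket_smul_right _ hf hY, inner_add_right, real_inner_smul_right,
          smul_eq_mul]
        ring
      add := fun {Y W} hY hW ↦ by
        rw [metric_add_right, dirDeriv_add (hξ.metric hY) (hξ.metric hW), Pi.add_apply,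
          dirDeriv_vec_add]
        simp only [metric, bracket_add_right _ hY hW, inner_add_right]
        ring }
  have h2 : ∀ {X Y : VF m M}, dirDeriv (metric ξ Y) x (X x) - dirDeriv (metric ξ X) x (Y x)
        - metric ξ (bracket X Y) x = -(dirDeriv (metric ξ X) x (Y x)
        - dirDeriv (metric ξ Y) x (X x) - metric ξ (bracket Y X) x) := fun {X Y} ↦ by
    rw [bracket_swap X Y]; simp only [metric, Pi.neg_apply, inner_neg_right]; ring
  have hi := SmoothVF.extend (E i x)
  have hj := SmoothVF.extend (E j x)
  -- The extensions are exchanged for frame fields one slot at a time: tensoriality is available in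
  -- the second slot, and the antisymmetry `h2` carries it to the first.
  have h3 := (h1 hi).pointwise hE hj (hE.smooth j) (extend_self _)
  have h4 := (h1 (hE.smooth j)).pointwise hE hi (hE.smooth i) (extend_self _)
  rw [h2 (X := extend (E i x)) (Y := E j), h4, ← h2] at h3
  rw [← h3, extDeriv, hM.eta_apply, hM.eta_apply, hM.eta_eq, extend_self, extend_self]
  rfl

end IsContactMetric

end HTensor

/-! ### Existence of contact frames (e, φe, ξ) -/

section ContactFrame

variable {M : Type*} [TopologicalSpace M] [ChartedSpace (EuclideanSpace ℝ (Fin 3)) M]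
  [IsManifold (𝓡 3) ∞ M]
  [Bundle.RiemannianBundle (fun x : M ↦ TangentSpace (𝓡 3) x)]
  [IsContMDiffRiemannianBundle (𝓡 3) ∞ (EuclideanSpace ℝ (Fin 3))
      (fun x : M ↦ TangentSpace (𝓡 3) x)]

variable {x : M} {E : Fin 3 → VF 3 M}
  {φ : EndField 3 M} {ξ : VF 3 M} {η : OneForm 3 M}

/-- A smooth orthonormal frame `(e, φ e, ξ)` near `x`. -/
structure IsContactFrame (φ : EndField 3 M) (ξ : VF 3 M) (E : Fin 3 → VF 3 M) (x : M) : Prop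
    extends IsFrame E x where
  two_eq : E 2 = ξ
  phi_zero : ∀ᶠ y in 𝓝 x, φ y (E 0 y) = E 1 y
  phi_one : ∀ᶠ y in 𝓝 x, φ y (E 1 y) = -E 0 y

theorem IsContactFrame.eventually (hE : IsContactFrame φ ξ E x) :
    ∀ᶠ y in 𝓝 x, IsContactFrame φ ξ E y := by
  filter_upwards [hE.toIsFrame.eventually, eventually_eventually_nhds.2 hE.phi_zero,
    eventually_eventually_nhds.2 hE.phi_one] with y h1 h2 h3
  exact ⟨h1, hE.two_eq, h2, h3⟩

namespace IsContactMetric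

/-- Near each point there is a smooth unit vector field orthogonal to `ξ`. -/
theorem exists_unit_orthogonal (hM : IsContactMetric φ ξ η) (x : M) :
    ∃ e : VF 3 M, SmoothVF e x ∧ ∀ᶠ y in 𝓝 x, inner ℝ (e y) (e y) = (1 : ℝ) ∧
      inner ℝ (ξ y) (e y) = (0 : ℝ) := by
  -- If every v were a multiple of ξ, the tangent space would have dimension at most 1 instead of 3.
  -- The component of an extension of v orthogonal to ξ stays nonzero near x and can be normalized.
  obtain ⟨v, hv⟩ : ∃ v : TangentSpace (𝓡 3) x, v - (inner ℝ (ξ x) v : ℝ) • ξ x ≠ 0 := by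
    by_contra! h
    have h1 : Module.finrank ℝ (TangentSpace (𝓡 3) x) ≤ 1 :=
      finrank_le_one (ξ x) fun w ↦ ⟨_, (sub_eq_zero.1 (h w)).symm⟩
    have h3 : Module.finrank ℝ (TangentSpace (𝓡 3) x) = 3 :=
      finrank_euclideanSpace_fin (𝕜 := ℝ) (n := 3)
    omega
  have hξ := hM.smoothVF_xi x
  have hV := SmoothVF.extend v
  let W : VF 3 M := extend v - metric ξ (extend v) • ξ
  have hW : SmoothVF W x := hV.sub (hξ.smul (hξ.metric hV))
  have hn := hW.metric hW
  have hpos : ∀ᶠ y in 𝓝 x, 0 < metric W W y := by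
    refine hn.contMDiffAt.continuousAt.eventually_const_lt ?_
    have : W x ≠ 0 := by
      simpa [W, metric, extend_self] using hv
    exact real_inner_self_pos.2 this
  refine ⟨(fun y ↦ (√(metric W W y))⁻¹) • W, hW.smul ?_, ?_⟩
  · filter_upwards [hn, hpos] with y h1 h2
    have h3 : ContDiffAt ℝ ∞ (fun t : ℝ ↦ (√t)⁻¹) (metric W W y) :=
      (Real.contDiffAt_sqrt h2.ne').inv (Real.sqrt_pos.2 h2).ne'
    exact h3.contMDiffAt.comp y h1
  · filter_upwards [hpos] with y hy
    simp only [Pi.smul_apply', real_inner_smul_left, real_inner_smul_right]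
    constructor
    · have h4 : inner ℝ (W y) (W y) = √(metric W W y) * √(metric W W y) :=
        (Real.mul_self_sqrt hy.le).symm
      rw [h4]
      have := (Real.sqrt_pos.2 hy).ne'
      field_simp
    · have : inner ℝ (ξ y) (W y) = (0 : ℝ) := by
        simp only [W, Pi.sub_apply, Pi.smul_apply', inner_sub_right, real_inner_smul_right,
          hM.inner_xi_xi, metric]
        ring
      rw [this, mul_zero]

theorem exists_contactFrame (hM : IsContactMetric φ ξ η) (x : M) :
    ∃ E : Fin 3 → VF 3 M, IsContactFrame φ ξ E x := by
  obtain ⟨e, he, h⟩ := hM.exists_unit_orthogonal x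
  let F : VF 3 M := fun y ↦ φ y (e y)
  have hη : ∀ᶠ y in 𝓝 x, φ y (F y) = -e y := by
    filter_upwards [h] with y hy
    rw [hM.phi_sq, hM.eta_eq, hy.2, zero_smul, add_zero]
  refine ⟨![e, F, ξ], ⟨⟨?_, ?_⟩, rfl, .of_forall fun _ ↦ rfl, hη⟩⟩
  · intro i
    fin_cases i
    exacts [he, hM.smoothVF_phi he, hM.smoothVF_xi x]
  · filter_upwards [h, hη] with y hy hφ
    have hξ := hM.inner_xi_xi y
    have hξF : inner ℝ (ξ y) (F y) = (0 : ℝ) := by rw [← hM.eta_eq, hM.eta_phi]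
    have hFF : inner ℝ (F y) (F y) = (1 : ℝ) := by
      rw [hM.metric_phi, hM.eta_eq, hy.1, hy.2]; ring
    have hFe : inner ℝ (F y) (e y) = (0 : ℝ) := by
      -- Applied to e and F = φe, with φF = -e, the compatibility of φ and g reads -g(F, e) = g(e,
      -- F), so both vanish.
      have h1 := hM.metric_phi y (e y) (F y)
      rw [hφ, hM.eta_eq y (e y), hy.2, inner_neg_right, real_inner_comm] at h1
      have h2 : inner ℝ (e y) (F y) = (inner ℝ (F y) (e y) : ℝ) := real_inner_comm _ _
      change -inner ℝ (e y) (F y) = _ at h1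
      linarith
    have heF : inner ℝ (e y) (F y) = (0 : ℝ) := by rw [real_inner_comm, hFe]
    have heξ : inner ℝ (e y) (ξ y) = (0 : ℝ) := by rw [real_inner_comm, hy.2]
    have hFξ : inner ℝ (F y) (ξ y) = (0 : ℝ) := by rw [real_inner_comm, hξF]
    intro i j
    fin_cases i <;> fin_cases j
    exacts [hy.1, heF, heξ, hFe, hFF, hFξ, hy.2, hξF, hξ]

end IsContactMetric

namespace IsContactFrame

/-- Since g(ξ, E j) is locally constant, the bracket term alone remains in dη, with its factor -1/2.
This is where the contact condition dη = g(·, φ·) enters. -/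
theorem structFn_two (hM : IsContactMetric φ ξ η) (hE : IsContactFrame φ ξ E x) (i j : Fin 3) :
    structFn E i j 2 x = -2 * inner ℝ (E i x) (φ x (E j x)) := by
  have h := hM.extDeriv_frame hE.toIsFrame i j
  have h0 : ∀ j (v : TangentSpace (𝓡 3) x), dirDeriv (metric ξ (E j)) x v = 0 := fun j v ↦ by
    rw [dirDeriv_congr (g := fun _ ↦ if 2 = j then 1 else 0), dirDeriv_const]
    filter_upwards [hE.orthonormal] with y hy
    rw [← hE.two_eq, hy]
  rw [hM.d_eta, h0, h0, metric_comm, ← hE.two_eq] at h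
  rw [structFn]
  linarith

end IsContactFrame
end ContactFrame

/-! ### The Ricci operator as the dual of the Ricci tensor -/

section InnerRicciOp

variable {m : ℕ} {M : Type*} [TopologicalSpace M] [ChartedSpace (EuclideanSpace ℝ (Fin m)) M]
  [IsManifold (𝓡 m) ∞ M]
  [Bundle.RiemannianBundle (fun x : M ↦ TangentSpace (𝓡 m) x)]
  [IsContMDiffRiemannianBundle (𝓡 m) ∞ (EuclideanSpace ℝ (Fin m))
      (fun x : M ↦ TangentSpace (𝓡 m) x)]

theorem inner_ricciOp {x : M} {E : Fin m → VF m M} (hE : IsFrame E x)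
    (v w : TangentSpace (𝓡 m) x) : inner ℝ (ricciOp v) w = ricci v w := by
  simp only [ricciOp, sum_inner, real_inner_smul_left, ricci_eq_sum hE, Finset.sum_mul]
  rw [Finset.sum_comm]
  refine Finset.sum_congr rfl fun j _ ↦ ?_
  rw [Finset.sum_comm]
  refine Finset.sum_congr rfl fun k _ ↦ ?_
  generalize ∑ i, metric (curvatureVF (E i) (E j) (E k)) (E i) x = r
  rw [real_inner_comm (E k x) w, ← (onb x).sum_inner_mul_inner (E k x) w, Finset.mul_sum,
    Finset.sum_mul]
  refine Finset.sum_congr rfl fun a _ ↦ ?_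
  rw [real_inner_comm (onb x a) (E k x)]
  ring

end InnerRicciOp

/-! ### Structure functions, Ricci curvature and tr h² in a contact frame -/

section ContactFrame

variable {M : Type*} [TopologicalSpace M] [ChartedSpace (EuclideanSpace ℝ (Fin 3)) M]
  [IsManifold (𝓡 3) ∞ M]
  [Bundle.RiemannianBundle (fun x : M ↦ TangentSpace (𝓡 3) x)]
  [IsContMDiffRiemannianBundle (𝓡 3) ∞ (EuclideanSpace ℝ (Fin 3))
      (fun x : M ↦ TangentSpace (𝓡 3) x)]

variable {x : M} {E : Fin 3 → VF 3 M}
  {φ : EndField 3 M} {ξ : VF 3 M} {η : OneForm 3 M}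

theorem structFn_self (E : Fin 3 → VF 3 M) (i k : Fin 3) : structFn E i i k = fun _ ↦ 0 := by
  funext y; linarith [structFn_swap E i i k y]

theorem dirDeriv_structFn_swap (E : Fin 3 → VF 3 M) (i j k : Fin 3)
    (v : TangentSpace (𝓡 3) x) :
    dirDeriv (structFn E i j k) x v = -dirDeriv (structFn E j i k) x v := by
  rw [← dirDeriv_neg]
  exact congrArg (dirDeriv · x v) (funext fun y ↦ structFn_swap E i j k y)

namespace IsContactFrame

theorem structFn_zero_one_two (hM : IsContactMetric φ ξ η) (hE : IsContactFrame φ ξ E x) :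
    structFn E 0 1 2 x = 2 := by
  have h : inner ℝ (E 0 x) (E 0 x) = (1 : ℝ) := hE.orthonormal.self_of_nhds 0 0
  rw [hE.structFn_two hM, hE.phi_one.self_of_nhds, inner_neg_right, h]
  norm_num

theorem structFn_two_zero_two (hM : IsContactMetric φ ξ η) (hE : IsContactFrame φ ξ E x) :
    structFn E 2 0 2 x = 0 := by
  have h : inner ℝ (E 2 x) (E 1 x) = (0 : ℝ) := hE.orthonormal.self_of_nhds 2 1
  rw [hE.structFn_two hM, hE.phi_zero.self_of_nhds, h, mul_zero]

theorem structFn_two_one_two (hM : IsContactMetric φ ξ η) (hE : IsContactFrame φ ξ E x) :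
    structFn E 2 1 2 x = 0 := by
  have h : inner ℝ (E 2 x) (E 0 x) = (0 : ℝ) := hE.orthonormal.self_of_nhds 2 0
  rw [hE.structFn_two hM, hE.phi_one.self_of_nhds, inner_neg_right, h, neg_zero, mul_zero]

/-- An identity proved at every point carrying a contact frame holds on a neighbourhood, because the
contact frame condition is open; so it can be differentiated. -/
theorem dirDeriv_eq_zero (hE : IsContactFrame φ ξ E x) {f : M → ℝ} {c : ℝ}
    (h : ∀ {y}, IsContactFrame φ ξ E y → f y = c) (v : TangentSpace (𝓡 3) x) :
    dirDeriv f x v = 0 := by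
  rw [dirDeriv_congr (g := fun _ ↦ c), dirDeriv_const]
  filter_upwards [hE.eventually] with y hy using h hy

/-- This is the ξ-component of the Jacobi identity for e, φe, ξ. All ξ-components of the brackets
are constant, so the derivative terms vanish and -2 times the sum of the two structure functions is
left. -/
theorem structFn_two_one_one (hM : IsContactMetric φ ξ η) (hE : IsContactFrame φ ξ E x) :
    structFn E 2 1 1 x = -structFn E 2 0 0 x := by
  have h := hE.jacobi 0 1 2 2
  rw [dirDeriv_structFn_swap E 1 2, hE.dirDeriv_eq_zero fun hy ↦ hy.structFn_two_one_two hM,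
    hE.dirDeriv_eq_zero fun hy ↦ hy.structFn_two_zero_two hM,
    hE.dirDeriv_eq_zero fun hy ↦ hy.structFn_zero_one_two hM] at h
  simp only [Fin.sum_univ_three, structFn_self, structFn_swap E 1 2, structFn_swap E 1 0,
    structFn_swap E 0 2, hE.structFn_zero_one_two hM,
    hE.structFn_two_zero_two hM, hE.structFn_two_one_two hM] at h
  linarith

theorem dirDeriv_structFn_two_one_one (hM : IsContactMetric φ ξ η)
    (hE : IsContactFrame φ ξ E x) (v : TangentSpace (𝓡 3) x) :
    dirDeriv (structFn E 2 1 1) x v = -dirDeriv (structFn E 2 0 0) x v := by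
  rw [← dirDeriv_neg]
  refine dirDeriv_congr ?_ v
  filter_upwards [hE.eventually] with y hy using hy.structFn_two_one_one hM

/-- Together with `jacobi_one`, this trades the ξ-derivatives of p = g([e, φe], e) and q = g([e,
φe], φe) for derivatives along e and φe. -/
theorem jacobi_zero (hM : IsContactMetric φ ξ η) (hE : IsContactFrame φ ξ E x) :
    dirDeriv (structFn E 0 1 0) x (E 2 x) = dirDeriv (structFn E 2 1 0) x (E 0 x)
      - dirDeriv (structFn E 2 0 0) x (E 1 x) - structFn E 2 0 0 x * structFn E 0 1 0 x
      - structFn E 2 1 0 x * structFn E 0 1 1 x := by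
  have h := hE.jacobi 0 1 2 0
  simp only [Fin.sum_univ_three, structFn_self, structFn_swap E 1 2, structFn_swap E 1 0,
    structFn_swap E 0 2, dirDeriv_structFn_swap E 1 2, hE.structFn_zero_one_two hM,
    hE.structFn_two_zero_two hM, hE.structFn_two_one_two hM, hE.structFn_two_one_one hM] at h
  linarith

theorem jacobi_one (hM : IsContactMetric φ ξ η) (hE : IsContactFrame φ ξ E x) :
    dirDeriv (structFn E 0 1 1) x (E 2 x) = -dirDeriv (structFn E 2 0 0) x (E 0 x)
      - dirDeriv (structFn E 2 0 1) x (E 1 x) + structFn E 2 0 0 x * structFn E 0 1 1 x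
      - structFn E 2 0 1 x * structFn E 0 1 0 x := by
  have h := hE.jacobi 0 1 2 1
  simp only [Fin.sum_univ_three, structFn_self, structFn_swap E 1 2, structFn_swap E 1 0,
    structFn_swap E 0 2, dirDeriv_structFn_swap E 1 2, hE.structFn_zero_one_two hM,
    hE.structFn_two_zero_two hM, hE.structFn_two_one_two hM, hE.structFn_two_one_one hM,
    hE.dirDeriv_structFn_two_one_one hM] at h
  linarith

/-- The Ricci tensor of a contact metric `3`-manifold in a contact frame, as a sum of explicit
terms in the structure functions. -/
theorem ricci_eq (hM : IsContactMetric φ ξ η) (hE : IsContactFrame φ ξ E x) :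
    ricci (E 2 x) (E 0 x) = structFn E 2 0 0 x * structFn E 0 1 1 x
        + (1 / 2) * dirDeriv (structFn E 2 0 1) x (E 1 x) - structFn E 2 1 0 x * structFn E 0 1 0 x
        - (1 / 2) * dirDeriv (structFn E 2 1 0) x (E 1 x)
        + dirDeriv (structFn E 0 1 1) x (E 2 x) ∧
    ricci (E 2 x) (E 1 x) = structFn E 2 0 0 x * structFn E 0 1 0 x
        + structFn E 2 0 1 x * structFn E 0 1 1 x
        - (1 / 2) * dirDeriv (structFn E 2 0 1) x (E 0 x)
        + (1 / 2) * dirDeriv (structFn E 2 1 0) x (E 0 x)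
        - dirDeriv (structFn E 0 1 0) x (E 2 x) ∧
    scalarCurvature 3 x = -2 + 2 * structFn E 2 0 1 x - 2 * structFn E 2 1 0 x
      - 2 * structFn E 0 1 0 x ^ 2 - 2 * structFn E 0 1 1 x ^ 2
      - 2 * dirDeriv (structFn E 0 1 0) x (E 1 x) + 2 * dirDeriv (structFn E 0 1 1) x (E 0 x)
      - 2 * structFn E 2 0 0 x ^ 2 - (1 / 2) * (structFn E 2 0 1 x + structFn E 2 1 0 x) ^ 2 := by
  have h1 : ∀ v : TangentSpace (𝓡 3) x, dirDeriv (structFn E 0 1 2) x v = 0 :=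
    hE.dirDeriv_eq_zero fun hy ↦ hy.structFn_zero_one_two hM
  have h2 : ∀ v : TangentSpace (𝓡 3) x, dirDeriv (structFn E 2 0 2) x v = 0 :=
    hE.dirDeriv_eq_zero fun hy ↦ hy.structFn_two_zero_two hM
  have h3 : ∀ v : TangentSpace (𝓡 3) x, dirDeriv (structFn E 2 1 2) x v = 0 :=
    hE.dirDeriv_eq_zero fun hy ↦ hy.structFn_two_one_two hM
  have h4 := hE.dirDeriv_structFn_two_one_one hM
  -- The right-hand side is left to unification: it is the contraction of the frame formula for the
  -- curvature, which is then evaluated with the known structure functions.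
  have key : ∀ j k, ricci (E j x) (E k x) = _ := fun j k ↦
    (ricci_frame hE.toIsFrame j k).trans
      (Finset.sum_congr rfl fun i _ ↦ hE.metric_curvatureVF i j k i)
  rw [scalarCurvature_eq_sum hE.toIsFrame]
  simp only [key, Fin.sum_univ_three, hE.dirDeriv_connFn]
  simp only [connFn, structFn_self, dirDeriv_const, structFn_swap E 1 2,
    structFn_swap E 1 0, structFn_swap E 0 2, dirDeriv_structFn_swap E 1 2,
    dirDeriv_structFn_swap E 1 0, dirDeriv_structFn_swap E 0 2,
    hE.structFn_zero_one_two hM, hE.structFn_two_zero_two hM, hE.structFn_two_one_two hM,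
    hE.structFn_two_one_one hM, h1, h2, h3, h4]
  refine ⟨?_, ?_, ?_⟩ <;> ring

/-- In the notation a, b, c for the components of [ξ, e] and [ξ, φe], one finds h e = ((b + c)/2) e
- a φe, h φe = -a e - ((b + c)/2) φe and hξ = 0. -/
theorem trHSq_eq (hM : IsContactMetric φ ξ η) (hE : IsContactFrame φ ξ E x) :
    trHSq φ ξ x = 2 * structFn E 2 0 0 x ^ 2
      + (1 / 2) * (structFn E 2 0 1 x + structFn E 2 1 0 x) ^ 2 := by
  have hon : ∀ i j, inner ℝ (E i x) (E j x) = if i = j then (1 : ℝ) else 0 :=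
    fun i j ↦ hE.orthonormal.self_of_nhds i j
  have hb : ∀ j, bracket ξ (E j) x = ∑ k, structFn E 2 j k x • E k x := fun j ↦ by
    rw [← hE.two_eq, hE.bracket_eq]
  have hφ2 : φ x (E 2 x) = 0 := by rw [hE.two_eq, hM.phi_xi]
  have e0 : hTensor φ ξ x (E 0 x) = (1 / 2 : ℝ) • (bracket ξ (E 1) x - φ x (bracket ξ (E 0) x)) := by
    rw [hM.hTensor_frame hE.toIsFrame,
      bracket_congr (Y' := E 1) (X' := ξ) (.of_forall fun _ ↦ rfl) hE.phi_zero]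
  have e1 : hTensor φ ξ x (E 1 x) =
      (1 / 2 : ℝ) • (-bracket ξ (E 0) x - φ x (bracket ξ (E 1) x)) := by
    rw [hM.hTensor_frame hE.toIsFrame,
      bracket_congr (Y' := (fun _ : M ↦ (-1 : ℝ)) • E 0) (X' := ξ) (.of_forall fun _ ↦ rfl)
      (hE.phi_one.mono fun y hy ↦ hy.trans (by simp [Pi.smul_apply'])),
      bracket_smul_right _ (SmoothFn.const _ x) (hE.smooth 0), dirDeriv_const]
    module
  have e2 : hTensor φ ξ x (E 2 x) = 0 := by
    rw [hM.hTensor_frame hE.toIsFrame,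
      bracket_congr (Y' := (fun _ : M ↦ (0 : ℝ)) • E 0) (X' := ξ) (.of_forall fun _ ↦ rfl)
      (.of_forall fun y ↦ by rw [hE.two_eq, hM.phi_xi]; simp [Pi.smul_apply']),
      bracket_smul_right _ (SmoothFn.const _ x) (hE.smooth 0), dirDeriv_const, hb 2]
    simp [structFn_self]
  rw [hM.trHSq_eq_sum hE.toIsFrame]
  simp only [Fin.sum_univ_three, e0, e1, e2, hb, map_add, map_smul, hE.phi_zero.self_of_nhds,
    hE.phi_one.self_of_nhds, hφ2, real_inner_smul_left, inner_sub_left, inner_add_left,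
    inner_neg_left, inner_zero_left, hon, hE.structFn_two_zero_two hM,
    hE.structFn_two_one_two hM, hE.structFn_two_one_one hM]
  simp
  ring

end IsContactFrame

end ContactFrame

/-! ### Term-by-term differentiation of explicit expressions -/

section HasDirDeriv

variable {m : ℕ} {M : Type*} [TopologicalSpace M] [ChartedSpace (EuclideanSpace ℝ (Fin m)) M]

/-- The function `f` is smooth near `x` and has derivative `d` in the direction `v`. -/
def HasDirDeriv (f : M → ℝ) (x : M) (v : TangentSpace (𝓡 m) x) (d : ℝ) : Prop :=
  SmoothFn m f x ∧ dirDeriv f x v = d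

namespace HasDirDeriv

variable {f g : M → ℝ} {x : M} {v : TangentSpace (𝓡 m) x} {d d' : ℝ}

theorem const (c : ℝ) (v : TangentSpace (𝓡 m) x) : HasDirDeriv (fun _ ↦ c) x v 0 :=
  ⟨SmoothFn.const c x, dirDeriv_const c v⟩

theorem add (hf : HasDirDeriv f x v d) (hg : HasDirDeriv g x v d') :
    HasDirDeriv (fun y ↦ f y + g y) x v (d + d') :=
  ⟨hf.1.add hg.1, by rw [dirDeriv_add hf.1 hg.1, hf.2, hg.2]⟩

theorem sub (hf : HasDirDeriv f x v d) (hg : HasDirDeriv g x v d') :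
    HasDirDeriv (fun y ↦ f y - g y) x v (d - d') :=
  ⟨hf.1.sub hg.1, by rw [dirDeriv_sub hf.1 hg.1, hf.2, hg.2]⟩

theorem mul (hf : HasDirDeriv f x v d) (hg : HasDirDeriv g x v d') :
    HasDirDeriv (fun y ↦ f y * g y) x v (f x * d' + g x * d) :=
  ⟨hf.1.mul hg.1, by rw [dirDeriv_mul hf.1 hg.1, hf.2, hg.2]⟩

theorem const_mul (c : ℝ) (hf : HasDirDeriv f x v d) :
    HasDirDeriv (fun y ↦ c * f y) x v (c * d) := by
  simpa using (const c v).mul hf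

theorem congr (hf : HasDirDeriv f x v d) (h : ∀ᶠ y in 𝓝 x, g y = f y) :
    HasDirDeriv g x v d :=
  ⟨hf.1.congr h, by rw [dirDeriv_congr h, hf.2]⟩

theorem eq_zero (hf : HasDirDeriv f x v d) (h : ∀ᶠ y in 𝓝 x, f y = 0) : d = 0 := by
  rw [← hf.2, dirDeriv_congr (g := fun _ ↦ 0) h, dirDeriv_const]

end HasDirDeriv

end HasDirDeriv

/-! ### The H-contact condition and the derivative of τ + tr h² along ξ -/

section ContactFrame

variable {M : Type*} [TopologicalSpace M] [ChartedSpace (EuclideanSpace ℝ (Fin 3)) M]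
  [IsManifold (𝓡 3) ∞ M]
  [Bundle.RiemannianBundle (fun x : M ↦ TangentSpace (𝓡 3) x)]
  [IsContMDiffRiemannianBundle (𝓡 3) ∞ (EuclideanSpace ℝ (Fin 3))
      (fun x : M ↦ TangentSpace (𝓡 3) x)]

variable {x : M} {E : Fin 3 → VF 3 M}
  {φ : EndField 3 M} {ξ : VF 3 M} {η : OneForm 3 M}

/-- Only orthogonality of ξ to e and φe is used, so the eigenvalue f disappears and its regularity
never matters. -/
theorem IsContactFrame.ricci_eq_zero (hE : IsContactFrame φ ξ E x) (hH : IsHContact ξ) :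
    ricci (E 2 x) (E 0 x) = 0 ∧ ricci (E 2 x) (E 1 x) = 0 := by
  obtain ⟨f, hf⟩ := hH
  have h : ∀ j : Fin 3, ricci (E 2 x) (E j x) = f x * (if 2 = j then 1 else 0) := fun j ↦ by
    rw [← inner_ricciOp hE.toIsFrame, ← hE.orthonormal.self_of_nhds 2 j, metric, hE.two_eq, hf,
      real_inner_smul_left]
  rw [h, h]
  simp

theorem IsContactFrame.hasDirDeriv_scalarCurvature_add_trHSq (hM : IsContactMetric φ ξ η)
    (hH : IsHContact ξ) (hE : IsContactFrame φ ξ E x) :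
    HasDirDeriv (fun y ↦ scalarCurvature 3 y + trHSq φ ξ y) x (E 2 x) 0 := by
  have hs : ∀ i j k l, HasDirDeriv (structFn E i j k) x (E l x)
      (dirDeriv (structFn E i j k) x (E l x)) := fun i j k l ↦ ⟨hE.smoothFn_structFn i j k, rfl⟩
  have hd : ∀ i j k n l, HasDirDeriv (fun y ↦ dirDeriv (structFn E i j k) y (E n y)) x (E l x)
      (dirDeriv (fun y ↦ dirDeriv (structFn E i j k) y (E n y)) x (E l x)) := fun i j k n l ↦
    ⟨hE.smoothFn_dirDeriv 0 (hE.smoothFn_structFn i j k) (hE.smooth n), rfl⟩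
  -- The nesting reproduces the formula for ρ(ξ, e) in `ricci_eq`, here differentiated along e;
  -- `hR1` does the same for ρ(ξ, φe) along φe.
  have hR0 := (((((hs 2 0 0 0).mul (hs 0 1 1 0)).add ((hd 2 0 1 1 0).const_mul (1 / 2))).sub
    ((hs 2 1 0 0).mul (hs 0 1 0 0))).sub ((hd 2 1 0 1 0).const_mul (1 / 2))).add
    (hd 0 1 1 2 0) |>.eq_zero (by
      filter_upwards [hE.eventually] with y hy
      rw [← (hy.ricci_eq hM).1, (hy.ricci_eq_zero hH).1])
  have hR1 := (((((hs 2 0 0 1).mul (hs 0 1 0 1)).add ((hs 2 0 1 1).mul (hs 0 1 1 1))).sub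
    ((hd 2 0 1 0 1).const_mul (1 / 2))).add ((hd 2 1 0 0 1).const_mul (1 / 2))).sub
    (hd 0 1 0 2 1) |>.eq_zero (by
      filter_upwards [hE.eventually] with y hy
      rw [← (hy.ricci_eq hM).2.1, (hy.ricci_eq_zero hH).2])
  -- The terms -2a² - (b + c)²/2 of τ are missing because tr h² cancels them.
  have hF := (((((((HasDirDeriv.const (-2) (E 2 x)).add ((hs 2 0 1 2).const_mul 2)).sub
    ((hs 2 1 0 2).const_mul 2)).sub (((hs 0 1 0 2).mul (hs 0 1 0 2)).const_mul 2)).sub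
    (((hs 0 1 1 2).mul (hs 0 1 1 2)).const_mul 2)).sub ((hd 0 1 0 1 2).const_mul 2)).add
    ((hd 0 1 1 0 2).const_mul 2)).congr (g := fun y ↦ scalarCurvature 3 y + trHSq φ ξ y) (by
      filter_upwards [hE.eventually] with y hy
      rw [(hy.ricci_eq hM).2.2, hy.trHSq_eq hM]
      ring)
  convert hF using 1
  have r0 := (hE.ricci_eq hM).1
  have r1 := (hE.ricci_eq hM).2.1
  rw [(hE.ricci_eq_zero hH).1] at r0
  rw [(hE.ricci_eq_zero hH).2] at r1
  have c1 := hE.dirDeriv_comm (hE.smoothFn_structFn 2 0 1) 0 1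
  have c2 := hE.dirDeriv_comm (hE.smoothFn_structFn 2 1 0) 0 1
  have c3 := hE.dirDeriv_comm (hE.smoothFn_structFn 0 1 1) 2 0
  have c4 := hE.dirDeriv_comm (hE.smoothFn_structFn 0 1 0) 2 1
  simp only [Fin.sum_univ_three, hE.structFn_zero_one_two hM, hE.structFn_two_zero_two hM,
    hE.structFn_two_one_two hM, hE.structFn_two_one_one hM] at c1 c2 c3 c4
  have j0 := hE.jacobi_zero hM
  have j1 := hE.jacobi_one hM
  -- `c1` and `c2` turn the mixed second derivatives of b and c into first derivatives, including ξb
  -- and ξc; `c3` and `c4` move ξ past e on q and past φe on p. The terms 4pξp and 4qξq are then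
  -- removed half by the Ricci equations `r1`, `r0` and half by the Jacobi identities `j0`, `j1`.
  linear_combination (-2) * hR0 - 2 * hR1 + c1 - c2 - 2 * c3 + 2 * c4
    - 2 * structFn E 0 1 1 x * r0 + 2 * structFn E 0 1 0 x * r1
    + 2 * structFn E 0 1 0 x * j0 + 2 * structFn E 0 1 1 x * j1

end ContactFrame

end ContactMetric

theorem mainTheorem6 {M : Type*} [TopologicalSpace M]
    [ChartedSpace (EuclideanSpace ℝ (Fin 3)) M] [IsManifold (𝓡 3) ∞ M]
    [Bundle.RiemannianBundle (fun x : M ↦ TangentSpace (𝓡 3) x)]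
    [IsContMDiffRiemannianBundle (𝓡 3) ∞ (EuclideanSpace ℝ (Fin 3))
      (fun x : M ↦ TangentSpace (𝓡 3) x)]
    (φ : ContactMetric.EndField 3 M) (ξ : ContactMetric.VF 3 M) (η : ContactMetric.OneForm 3 M)
    (hM : ContactMetric.IsContactMetric φ ξ η) (hH : ContactMetric.IsHContact ξ) :
    ∀ x : M,
      MDifferentiableAt (𝓡 3) 𝓘(ℝ, ℝ)
        (fun y ↦ ContactMetric.scalarCurvature 3 y + ContactMetric.trHSq φ ξ y) x ∧
      ContactMetric.dirDeriv
        (fun y ↦ ContactMetric.scalarCurvature 3 y + ContactMetric.trHSq φ ξ y) x (ξ x) = 0 := by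
  intro x
  obtain ⟨E, hE⟩ := hM.exists_contactFrame x
  have h := hE.hasDirDeriv_scalarCurvature_add_trHSq hM hH
  rw [hE.two_eq] at h
  exact ⟨h.1.mdifferentiableAt, h.2⟩
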